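/- Setting. Let $\mathbb X$ be a Polish space with its Borel $\sigma$-algebra, $\pi_0$ a probability measure on $\mathbb X$, $f$ a probability kernel on $\mathbb X$, and $g_n:\mathbb X\to(0,\infty)$, $n\ge 0$, bounded measurable functions (the likelihoods $g(\cdot,y_n)$ of a fixed observation sequence). The prediction filters are $\pi_{n+1}(A)=\int g_n(x)f(x,A)\,\pi_n(dx)\big/\int g_n(x)\,\pi_n(dx)$. Put $Q_n(x,dx')=g_{n-1}(x)f(x,dx')$ for $n\ge1$, $\gamma_n=\pi_0Q_1\cdots Q_n$, $Q_n^{\otimes2}(x,y,d(x',y'))=Q_n(x,dx')Q_n(y,dy')$, and for bounded measurable $\psi$ on $\mathbb X^2$ put $\mathcal C_0(\psi)(x,y)=\psi(x,y)$, $\mathcal C_1(\psi)(x,y)=\psi(x,x)$. Write $[N]=\{1,\dots,N\}$, and $k \bmod N$ for the representative of $k$ in $[N]$. Algorithm. Given a row-stochastic $N\times N$ matrix $\alpha_N$, let $W_0^i=1$ and let $\zeta_0^i$, $i\in[N]$, be independent with law $\pi_0$; for $n\ge1$ let $W_n^i=\sum_j\alpha_N^{ij}W_{n-1}^jg_{n-1}(\zeta_{n-1}^j)$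 and, given $\zeta_0,\dots,\zeta_{n-1}$, let the $\zeta_n^i$, $i\in[N]$, be conditionally independent with law $(W_n^i)^{-1}\sum_j\alpha_N^{ij}W_{n-1}^jg_{n-1}(\zeta_{n-1}^j)f(\zeta_{n-1}^j,\cdot)$. Let $\pi_n^N(\varphi)=\sum_iW_n^i\varphi(\zeta_n^i)\big/\sum_iW_n^i$. Assumption on $\alpha$. Let $M>1$ and $\beta\geq 1$ be fixed integers. For all $N\in\{Mm:m\ge1\}$: (1) $\alpha_N$ is doubly stochastic; (2) $\alpha_N^{ij}=\alpha_N^{(i+zM)\bmod N,\,(j+zM)\bmod N}$ for all $i,j\in[N]$, $z\in\mathbb Z$; (3) if $N\ge2\beta+1$, then $\alpha_N^{ij}=0$ whenever $\min_{\ell\in\mathbb Z}|i-j+\ell N|>\beta$; (4) there is a matrix $(\alpha_\infty^{ij})_{i,j\in\mathbb Z}$, independent of $N$, such that $\alpha_\infty^{ij}=\alpha_N^{i\bmod N,\,j\bmod N}\,\mathbb I[|i-j|\le\beta]$ for all $i,j\in\mathbb Z$ and all such $N\ge2\beta+1$. Theorem. Under this assumption, let $\varphi$ be bounded and measurable, let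 $n\ge0$, and let $\sigma_0^2=\pi_0((\varphi-\pi_0(\varphi))^2)$ and, for $n\ge1$, with $\overline\varphi=\varphi-\pi_n(\varphi)$ and $\overline\varphi^{\otimes2}(x,y)=\overline\varphi(x)\overline\varphi(y)$, $$\sigma_n^2=\frac1{\gamma_n(\mathbf 1)^2M}\sum_{0\le u<M}\ \sum_{|v|\le2n\beta}\mathbb E_{u,u+v}\Big[\pi_0^{\otimes2}\mathcal C_{\epsilon_0}Q_1^{\otimes2}\mathcal C_{\epsilon_1}\cdots Q_n^{\otimes2}\mathcal C_{\epsilon_n}\big(\overline\varphi^{\otimes2}\big)\Big],\qquad \epsilon_k=\mathbb I[I_k=J_k],$$ where $\mathbb E_{u,v}$ is the expectation for the backward Markov chain $(I_k,J_k)_{0\le k\le n}$ with $(I_n,J_n)=(u,v)$ and $\mathbb P(I_k=i,J_k=j\mid I_{k+1}=i',J_{k+1}=j')=\alpha_\infty^{i'i}\alpha_\infty^{j'j}$. If $\sigma_n^2>0$, then $$\sqrt N\big(\pi_n^N(\varphi)-\pi_n(\varphi)\big)\longrightarrow\mathcal N(0,\sigma_n^2)$$ in distribution, as $N=Mm$,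 $m\to\infty$. In particular, let $0\le\theta\le M-1$, and consider the particle system with groups $G_k=\{(k-1)M+1,\dots,kM\}$, $k\in[m]$, and $L^j=(j+\theta)\bmod N$, where $N = Mm$, $W^i_0=1$, the $\zeta_0^i$ are independent with law $\pi_0$, and for $i\in G_k$, $n\ge1$, $W_n^i=N^{-1}\sum_{j\in G_k}W_{n-1}^{L^j}g_{n-1}(\zeta_{n-1}^{L^j})$, the $\zeta_n^i$ being conditionally independent given $\zeta_0,\dots,\zeta_{n-1}$ with laws $$\frac{\sum_{j\in G_k}W_{n-1}^{L^j}g_{n-1}(\zeta_{n-1}^{L^j})f(\zeta_{n-1}^{L^j},\cdot)}{\sum_{j\in G_k}W_{n-1}^{L^j}g_{n-1}(\zeta_{n-1}^{L^j})}.$$ For $1\le\theta\le M-1$ this is the local exchange particle filter (LEPF); for $\theta=0$ it is $m$ independent bootstrap particle filters (IBPF). The same conclusion holds for it, with $\beta=M-1+\theta$ and $\alpha_\infty^{ij}=M^{-1}\mathbb I\big[\lfloor(i-1)/M\rfloor=\lfloor(j-\theta-1)/M\rfloor\big]$. -/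

import Mathlib

open MeasureTheory ProbabilityTheory Filter Topology

noncomputable section

namespace AlphaSMC

/-! ### The prediction filter -/

section Filtering

variable {X : Type*} [MeasurableSpace X]

/-- The measure `μ Q`, where `Q(x, A) = g(x) f(x, A)`. -/
def mulQ (g : X → ℝ) (f : Kernel X X) (μ : Measure X) : Measure X :=
  (μ.withDensity fun x => ENNReal.ofReal (g x)).bind f

/-- The map `Φ(μ)(A) = ∫ g(x) f(x, A) μ(dx) / ∫ g(x) μ(dx)`. -/
def predictionStep (g : X → ℝ) (f : Kernel X X) (μ : Measure X) : Measure X :=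
  (∫⁻ x, ENNReal.ofReal (g x) ∂μ)⁻¹ • mulQ g f μ

/-- The prediction filters `π_n`: `π_{n+1} = Φ_{n+1}(π_n)`, where `Φ_{n+1}` uses `g_n`. -/
def predictionFilter (π₀ : Measure X) (f : Kernel X X) (g : ℕ → X → ℝ) : ℕ → Measure X
  | 0 => π₀
  | n + 1 => predictionStep (g n) f (predictionFilter π₀ f g n)

/-- The unnormalised measures `γ_n = π₀ Q_1 ⋯ Q_n`, where `Q_{k+1}(x, A) = g_k(x) f(x, A)`. -/
def unnormalised (π₀ : Measure X) (f : Kernel X X) (g : ℕ → X → ℝ) : ℕ → Measure X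
  | 0 => π₀
  | n + 1 => mulQ (g n) f (unnormalised π₀ f g n)

/-- The operator `Q^{⊗2}` on functions of two variables, for `Q(x, dx') = g(x) f(x, dx')`:
`Q^{⊗2}(ψ)(x, y) = ∫∫ ψ(x', y') Q(x, dx') Q(y, dy')`. -/
def tensorQ (g : X → ℝ) (f : Kernel X X) (ψ : X × X → ℝ) : X × X → ℝ :=
  fun p => g p.1 * g p.2 * ∫ q, ψ q ∂((f p.1).prod (f p.2))

/-- The operators `C_0` (the identity) and `C_1`, with `C_1(ψ)(x, y) = ψ(x, x)`. -/
def collision (ε : Bool) (ψ : X × X → ℝ) : X × X → ℝ :=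
  fun p => if ε then ψ (p.1, p.1) else ψ p

/-- `C_{ε_0} Q_1^{⊗2} C_{ε_1} ⋯ Q_n^{⊗2} C_{ε_n}(ψ)`. -/
def tensorChain (f : Kernel X X) (g : ℕ → X → ℝ) :
    (n : ℕ) → (Fin (n + 1) → Bool) → (X × X → ℝ) → X × X → ℝ
  | 0, ε, ψ => collision (ε 0) ψ
  | n + 1, ε, ψ => tensorChain f g n (fun k => ε k.castSucc)
      (tensorQ (g n) f (collision (ε (Fin.last (n + 1))) ψ))

/-- The probability that the backward chain `(I_k, J_k)_{0 ≤ k ≤ n}` which starts at time `n`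
from `(u, v)`, and whose two components move independently with transitions `α_∞`, follows the
path `p`. -/
def pathWeight (αinf : ℤ → ℤ → ℝ) (n : ℕ) (u v : ℤ) (p : Fin (n + 1) → ℤ × ℤ) : ℝ :=
  (if p (Fin.last n) = (u, v) then 1 else 0) *
    ∏ k : Fin n, αinf (p k.succ).1 (p k.castSucc).1 * αinf (p k.succ).2 (p k.castSucc).2

/-- The law of the bivariate backward chain `(I_k, J_k)_{0 ≤ k ≤ n}` with `(I_n, J_n) = (u, v)`. -/
def backwardLaw (αinf : ℤ → ℤ → ℝ) (n : ℕ) (u v : ℤ) : Measure (Fin (n + 1) → ℤ × ℤ) :=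
  Measure.sum fun p => ENNReal.ofReal (pathWeight αinf n u v p) • Measure.dirac p

/-- The asymptotic variances `σ_n²`. -/
def asymptoticVariance (M β : ℕ) (αinf : ℤ → ℤ → ℝ) (π₀ : Measure X) (f : Kernel X X)
    (g : ℕ → X → ℝ) (φ : X → ℝ) : ℕ → ℝ
  | 0 => ∫ x, (φ x - ∫ y, φ y ∂π₀) ^ 2 ∂π₀
  | n + 1 =>
    let φbar : X → ℝ := fun x => φ x - ∫ y, φ y ∂(predictionFilter π₀ f g (n + 1))
    1 / ((unnormalised π₀ f g (n + 1)).real Set.univ ^ 2 * (M : ℝ)) *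
      ∑ u ∈ Finset.Ico (0 : ℤ) M,
        ∑ v ∈ Finset.Icc (-(2 * (n + 1 : ℤ) * β)) (2 * (n + 1 : ℤ) * β),
          ∫ p, (∫ q, tensorChain f g (n + 1) (fun k => decide ((p k).1 = (p k).2))
              (fun r => φbar r.1 * φbar r.2) q ∂(π₀.prod π₀))
            ∂(backwardLaw αinf (n + 1) u (u + v))

end Filtering

/-! ### The matrices

The index set `[N] = {1, …, N}` is identified with `ZMod N`, through `i ↦ (i : ZMod N)`; the
reduction of an integer to its representative in `{1, …, N}` becomes the cast `ℤ → ZMod N`. -/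

/-- The hypotheses on the matrices `α_N`, for `N` in `{M, 2 M, 3 M, …}`, with half-width `β` and
limiting doubly infinite matrix `α_∞`. (The values of `α` at other `N` are irrelevant.) -/
structure IsBandedFamily (M β : ℕ) (α : ∀ N : ℕ, Matrix (ZMod N) (ZMod N) ℝ)
    (αinf : ℤ → ℤ → ℝ) : Prop where
  doublyStochastic : ∀ (N : ℕ) [NeZero N], M ∣ N → α N ∈ doublyStochastic ℝ (ZMod N)
  periodic : ∀ (N : ℕ) [NeZero N], M ∣ N → ∀ i j z : ℤ,
    α N (i : ZMod N) (j : ZMod N) = α N ((i + z * M : ℤ) : ZMod N) ((j + z * M : ℤ) : ZMod N)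
  /-- Entries with `min_ℓ |i - j + ℓ N| > β` vanish. -/
  band : ∀ (N : ℕ) [NeZero N], M ∣ N → 2 * β + 1 ≤ N → ∀ i j : ℤ,
    (∀ l : ℤ, (β : ℤ) < |i - j + l * N|) → α N (i : ZMod N) (j : ZMod N) = 0
  limit : ∀ (N : ℕ) [NeZero N], M ∣ N → 2 * β + 1 ≤ N → ∀ i j : ℤ,
    αinf i j = if |i - j| ≤ (β : ℤ) then α N (i : ZMod N) (j : ZMod N) else 0

/-- The doubly infinite matrix
`α_∞^{ij} = M⁻¹ 𝟙[⌊(i - 1) / M⌋ = ⌊(j - θ - 1) / M⌋]` (floors are integer divisions here):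
the local exchange particle filter with exchange parameter `θ`, or, for `θ = 0`, independent
bootstrap particle filters. -/
def exchangeLimit (M θ : ℕ) (i j : ℤ) : ℝ :=
  if (i - 1) / (M : ℤ) = (j - θ - 1) / (M : ℤ) then (M : ℝ)⁻¹ else 0

/-! ### The algorithms -/

section Algorithms

variable {X : Type*} [MeasurableSpace X] {ι : Type*} [Fintype ι]

/-- The sigma-algebra generated by `ζ_0, …, ζ_n`. -/
abbrev history {Ω : Type*} (ζ : ℕ → ι → Ω → X) (n : ℕ) : MeasurableSpace Ω :=
  ⨆ k ∈ Set.Iic n, ⨆ i, MeasurableSpace.comap (ζ k i) inferInstance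

/-- `ζ_n = (ζ_n^i)_i`, `n ∈ ℕ`, are random particles on the probability space `(Ω, P)` such that
the `ζ_0^i` are independent with law `π₀` and, given `ζ_0, …, ζ_n`, the `ζ_{n+1}^i` are
conditionally independent with `P(ζ_{n+1}^i ∈ A | ζ_0, …, ζ_n) = κ_n^i(ζ, A)`. -/
structure IsParticleSystem (π₀ : Measure X) (κ : ℕ → ι → (ℕ → ι → X) → Set X → ℝ)
    {Ω : Type*} [MeasurableSpace Ω] (P : Measure Ω) (ζ : ℕ → ι → Ω → X) : Prop where
  measurable : ∀ n i, Measurable (ζ n i)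
  indep_zero : iIndepFun (ζ 0) P
  law_zero : ∀ i, P.map (ζ 0 i) = π₀
  cond_law : ∀ (n : ℕ) (A : ι → Set X), (∀ i, MeasurableSet (A i)) →
    P⟦{ω | ∀ i, ζ (n + 1) i ω ∈ A i} | history ζ n⟧
      =ᵐ[P] fun ω => ∏ i, κ n i (fun k j => ζ k j ω) (A i)

/-- The weights `W_0^i = 1`, `W_{n+1}^i = ∑_j α^{ij} W_n^j g_n(z_n^j)`. -/
def weight (α : Matrix ι ι ℝ) (g : ℕ → X → ℝ) (z : ℕ → ι → X) : ℕ → ι → ℝ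
  | 0, _ => 1
  | n + 1, i => ∑ j, α i j * weight α g z n j * g n (z n j)

/-- The sampling distributions
`A ↦ (W_{n+1}^i)⁻¹ ∑_j α^{ij} W_n^j g_n(z_n^j) f(z_n^j, A)`. -/
def sampling (α : Matrix ι ι ℝ) (f : Kernel X X) (g : ℕ → X → ℝ)
    (n : ℕ) (i : ι) (z : ℕ → ι → X) (A : Set X) : ℝ :=
  (weight α g z (n + 1) i)⁻¹ * ∑ j, α i j * weight α g z n j * g n (z n j) * (f (z n j)).real A

/-- `π_n^N(φ) = ∑_i W_n^i φ(z_n^i) / ∑_i W_n^i`, for weights `w = W_n` and particles `x = z_n`. -/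
def weightedMean (w : ι → ℝ) (x : ι → X) (φ : X → ℝ) : ℝ :=
  (∑ i, w i * φ (x i)) / ∑ i, w i

/-- The number `k - 1` of the group `G_k = {(k - 1) M + 1, …, (k - 1) M + M}` which contains
`i ∈ [N]`. -/
def groupIndex (M : ℕ) {N : ℕ} (i : ZMod N) : ℕ := (i - 1).val / M

/-- The weights of the local exchange particle filter with `L^j = j + θ` modulo `N`:
`W_0^i = 1` and `W_{n+1}^i = N⁻¹ ∑_{j ∈ G_k} W_n^{L^j} g_n(z_n^{L^j})` for `i ∈ G_k`. For `θ = 0`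
these are the weights of the independent bootstrap particle filters. -/
def exchangeWeight (M θ : ℕ) {N : ℕ} [NeZero N] (g : ℕ → X → ℝ) (z : ℕ → ZMod N → X) :
    ℕ → ZMod N → ℝ
  | 0, _ => 1
  | n + 1, i => (N : ℝ)⁻¹ * ∑ j : ZMod N with groupIndex M j = groupIndex M i,
      exchangeWeight M θ g z n (j + θ) * g n (z n (j + θ))

/-- The sampling distributions of the local exchange particle filter: for `i ∈ G_k`,
`∑_{j ∈ G_k} W_n^{L^j} g_n(z_n^{L^j}) f(z_n^{L^j}, A) / ∑_{j ∈ G_k} W_n^{L^j} g_n(z_n^{L^j})`.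
For `θ = 0` these are those of the independent bootstrap particle filters. -/
def exchangeSampling (M θ : ℕ) {N : ℕ} [NeZero N] (f : Kernel X X) (g : ℕ → X → ℝ)
    (n : ℕ) (i : ZMod N) (z : ℕ → ZMod N → X) (A : Set X) : ℝ :=
  (∑ j : ZMod N with groupIndex M j = groupIndex M i,
      exchangeWeight M θ g z n (j + θ) * g n (z n (j + θ)) * (f (z n (j + θ))).real A) /
    ∑ j : ZMod N with groupIndex M j = groupIndex M i,
      exchangeWeight M θ g z n (j + θ) * g n (z n (j + θ))

end Algorithms

end AlphaSMC

end

/-!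
# A central limit theorem for locally interacting particle filters

The weighted particles `(W_n^i, ζ_n^i)`, `i ∈ ZMod N`, form a Markov chain on configurations whose
transitions are products of kernels, the `i`-th of which only looks at the sites `j` with
`α^{ij} ≠ 0`, hence at sites at distance at most `β` from `i`. Three facts follow.

*Local dependence.* A transition maps a product of functions of disjoint sets of particles to the
product of their images, and enlarges the set of sites on which a function depends by `β`.
Hence, at time `n`, groups of particles at mutual distance more than `2 n β` are independent
(`IsParticleSystem.indepFun_of_disjoint_influence`).

*Moments.* The weighted particles are unbiased: `E[W_n^i h(ζ_n^i)] = γ_n(h)`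
(`IsParticleSystem.integral_weight_mul`). The second moments `E[W_n^u W_n^v ψ(ζ_n^u, ζ_n^v)]`
satisfy the recursion of the expectations over the backward chain `(I_k, J_k)`, in which the
operator `C_1` accounts for the case where both indices coincide. As long as the chain, which moves
by at most `β` in each step, cannot wrap around the cycle `ZMod N`, it can be run on the integers
with the matrix `α_∞` (`IsParticleSystem.integral_mul_eq_pathMoment`).

*Normal approximation.* If `S` is a sum of centred bounded variables with small dependency
neighbourhoods, then expanding `E[ξ_i exp (i t S)]` in the neighbours of `i` shows that the
characteristic function of `S` nearly satisfies `φ'(t) = -v t φ(t)`, where `v` is the sum of the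
covariances of neighbours; this is the equation of the Gaussian characteristic function
(`norm_integral_exp_sum_sub_exp_le`).

The normalised estimation error is the quotient of `N^{-1/2} ∑_i W_n^i (φ - π_n(φ))(ζ_n^i)` by
`N⁻¹ ∑_i W_n^i`. The numerator is a sum to which the normal approximation applies; by `M`-periodicity
of `α_∞`, its variance is `γ_n(1)² σ_n²` exactly, for large `N`. The denominator has mean `γ_n(1)`
and, again by local dependence, a variance of order `N⁻¹`, so that it may be replaced by `γ_n(1)` at
the cost of an error of order `N^{-1/2}` in the characteristic function
(`IsParticleSystem.norm_charFun_sub_le`). Lévy's continuity theorem concludes.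

The local exchange particle filter and the independent bootstrap particle filters are the general
algorithm for the matrices `α_N^{ij} = M⁻¹ 𝟙[j - θ lies in the group of i]`
(`isBandedFamily_exchangeMatrix`), up to a common factor `(M / N)^n` of the weights, which cancels in
the sampling distributions and in the estimator.
-/

noncomputable section

set_option linter.unusedSectionVars false

/-! ### A central limit theorem for sums with local dependence -/

/-- The second-order Taylor bound for `x ↦ exp (i x)`. -/
lemma norm_exp_ofReal_mul_I_sub_one_sub_le (x : ℝ) :
    ‖Complex.exp (x * Complex.I) - 1 - x * Complex.I‖ ≤ 2 * x ^ 2 := by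
  rcases le_or_gt |x| 1 with hx | hx
  · have h := Complex.norm_exp_sub_one_sub_id_le (x := x * Complex.I) (by simpa using hx)
    have h2 : ‖(x : ℂ) * Complex.I‖ = |x| := by simp
    rw [h2, sq_abs] at h
    nlinarith [sq_nonneg x]
  · have h1 : ‖Complex.exp (x * Complex.I) - 1‖ ≤ |x| := by
      simpa [mul_comm] using Real.norm_exp_I_mul_ofReal_sub_one_le (x := x)
    have h2 : ‖(x : ℂ) * Complex.I‖ = |x| := by simp
    calc _ ≤ ‖Complex.exp (x * Complex.I) - 1‖ + ‖(x : ℂ) * Complex.I‖ := norm_sub_le _ _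
      _ ≤ 2 * |x| := by linarith
      _ ≤ 2 * x ^ 2 := by
        rw [← sq_abs]
        nlinarith

lemma norm_exp_ofReal_mul_I_sub_le (x y : ℝ) :
    ‖Complex.exp (x * Complex.I) - Complex.exp (y * Complex.I)‖ ≤ |x - y| := by
  have h : Complex.exp (x * Complex.I) - Complex.exp (y * Complex.I)
      = Complex.exp (y * Complex.I) * (Complex.exp (Complex.I * (x - y : ℝ)) - 1) := by
    rw [mul_sub, ← Complex.exp_add]
    push_cast
    ring_nf
  rw [h, norm_mul, Complex.norm_exp_ofReal_mul_I, one_mul]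
  exact Real.norm_exp_I_mul_ofReal_sub_one_le

lemma abs_sum_le_card_mul {Ω ι : Type*} {ξ : ι → Ω → ℝ} {a : ℝ} (hb : ∀ i ω, |ξ i ω| ≤ a)
    (ha : 0 ≤ a) {N : Finset ι} {L : ℕ} (hL : N.card ≤ L) (ω : Ω) : |∑ k ∈ N, ξ k ω| ≤ L * a :=
  calc |∑ k ∈ N, ξ k ω| ≤ ∑ k ∈ N, |ξ k ω| := Finset.abs_sum_le_sum_abs _ _
    _ ≤ N.card • a := Finset.sum_le_card_nsmul _ _ _ fun k _ => hb k ω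
    _ ≤ L * a := by
      rw [nsmul_eq_mul]
      gcongr

section LocalDependence

variable {Ω ι : Type*} [MeasurableSpace Ω] {P : Measure Ω}

/-- The characteristic function `φ` of a bounded random variable has derivative
`φ'(t) = i E[S exp (i t S)]`. -/
lemma hasDerivAt_integral_exp_mul_I [IsProbabilityMeasure P] {S : Ω → ℝ} (hS : Measurable S) {K : ℝ}
    (hK : ∀ ω, |S ω| ≤ K) (t : ℝ) :
    HasDerivAt (fun t : ℝ => ∫ ω, Complex.exp ((t * S ω : ℝ) * Complex.I) ∂P)
      (∫ ω, (S ω * Complex.I) * Complex.exp ((t * S ω : ℝ) * Complex.I) ∂P) t := by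
  refine (hasDerivAt_integral_of_dominated_loc_of_deriv_le (bound := fun _ => K)
    (F' := fun t ω => (S ω * Complex.I) * Complex.exp ((t * S ω : ℝ) * Complex.I))
    (Filter.univ_mem (f := 𝓝 t)) ?_ ?_ ?_ ?_ (integrable_const _) ?_).2
  · exact Eventually.of_forall fun s => by fun_prop
  · refine Integrable.of_bound (C := 1) (by fun_prop) (ae_of_all _ fun ω => ?_)
    rw [Complex.norm_exp_ofReal_mul_I]
  · fun_prop
  · refine ae_of_all _ fun ω s _ => ?_
    rw [norm_mul, Complex.norm_exp_ofReal_mul_I]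
    simpa using hK ω
  · refine ae_of_all _ fun ω s _ => ?_
    have h : HasDerivAt (fun s : ℝ => ((s * S ω : ℝ) : ℂ) * Complex.I) (S ω * Complex.I) s := by
      have := ((hasDerivAt_id s).mul_const (S ω)).ofReal_comp.mul_const Complex.I
      simpa using this
    simpa [mul_comm] using h.cexp

variable [Fintype ι] [DecidableEq ι]

/-- The family `ξ` has dependency neighbourhoods `nb`: two finite subfamilies are independent as
soon as no index of the second is a neighbour of an index of the first. -/
def HasDependencyNeighborhoods (ξ : ι → Ω → ℝ) (P : Measure Ω) (nb : ι → Finset ι) : Prop :=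
  ∀ A B : Finset ι, (∀ i ∈ A, Disjoint (nb i) B) →
    IndepFun (fun ω (k : A) => ξ k ω) (fun ω (k : B) => ξ k ω) P

variable {ξ : ι → Ω → ℝ} {a : ℝ} {nb : ι → Finset ι} {D : ℕ}

/-- A centred function of the `ξ_k`, `k ∈ A`, is uncorrelated with `exp (i t ∑ ξ_k)` when the sum
only extends over the indices which are not neighbours of `A`. -/
lemma integral_mul_exp_sum_compl_eq_zero (hm : ∀ i, Measurable (ξ i))
    (hind : HasDependencyNeighborhoods ξ P nb) (A : Finset ι) {h : (A → ℝ) → ℂ}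
    (hh : Measurable h) (hmean : ∫ ω, h (fun k => ξ k ω) ∂P = 0) (t : ℝ) :
    ∫ ω, h (fun k => ξ k ω) *
      Complex.exp ((t * ∑ k ∈ (A.biUnion nb)ᶜ, ξ k ω : ℝ) * Complex.I) ∂P = 0 := by
  set N := A.biUnion nb with hN
  have hi : IndepFun (fun ω (k : A) => ξ k ω) (fun ω (k : (Nᶜ : Finset ι)) => ξ k ω) P := by
    refine hind A Nᶜ fun i hi => ?_
    rw [Finset.disjoint_left]
    intro k hk hk'
    exact (Finset.mem_compl.1 hk') (Finset.mem_biUnion.2 ⟨i, hi, hk⟩)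
  have h1 : Measurable fun x : ((Nᶜ : Finset ι) → ℝ) =>
      Complex.exp ((t * ∑ k, x k : ℝ) * Complex.I) := by fun_prop
  have h2 := hi.comp hh h1
  have h3 := h2.integral_fun_mul_eq_mul_integral
    (hh.comp (measurable_pi_lambda _ fun k => hm k)).aestronglyMeasurable
    (h1.comp (measurable_pi_lambda _ fun k => hm k)).aestronglyMeasurable
  simp only [Function.comp_def] at h3
  rw [hmean, zero_mul] at h3
  rw [← h3]
  congr 1
  ext ω
  rw [← Finset.sum_coe_sort (Nᶜ) (fun k => ξ k ω)]

variable [IsProbabilityMeasure P]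

/-- A centred bounded variable `h((ξ_k)_{k ∈ A})` is nearly uncorrelated with
`exp (i t ∑ ξ_k)`: only the neighbours of `A` contribute. -/
lemma norm_integral_mul_exp_le (hm : ∀ i, Measurable (ξ i)) (hb : ∀ i ω, |ξ i ω| ≤ a)
    (ha : 0 ≤ a) (hind : HasDependencyNeighborhoods ξ P nb) (A : Finset ι) {L : ℕ}
    (hL : (A.biUnion nb).card ≤ L) {h : (A → ℝ) → ℂ} (hh : Measurable h) {b : ℝ}
    (hη : ∀ ω, ‖h fun k => ξ k ω‖ ≤ b) (hmean : ∫ ω, h (fun k => ξ k ω) ∂P = 0) (t : ℝ) :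
    ‖∫ ω, h (fun k => ξ k ω) * Complex.exp ((t * ∑ k, ξ k ω : ℝ) * Complex.I) ∂P‖
      ≤ b * (|t| * (L * a)) := by
  have hb0 : 0 ≤ b := by
    obtain ⟨ω⟩ := nonempty_of_isProbabilityMeasure P
    exact (norm_nonneg _).trans (hη ω)
  have hhm : Measurable fun ω => h fun k => ξ k ω := hh.comp (measurable_pi_lambda _ fun k => hm k)
  have hz := integral_mul_exp_sum_compl_eq_zero hm hind A hh hmean t
  set N := A.biUnion nb with hN
  have hS (ω) : |t * ∑ k, ξ k ω - t * ∑ k ∈ Nᶜ, ξ k ω| ≤ |t| * (L * a) := by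
    rw [← mul_sub, abs_mul, ← Finset.sum_add_sum_compl N, add_sub_cancel_right]
    gcongr
    exact abs_sum_le_card_mul hb ha hL ω
  rw [← sub_zero (∫ ω, _ ∂P), ← hz, ← integral_sub]
  · refine (norm_integral_le_of_norm_le_const (C := b * (|t| * (L * a)))
      (ae_of_all _ fun ω => ?_)).trans ?_
    · rw [← mul_sub, norm_mul]
      gcongr
      · exact hη ω
      · exact (norm_exp_ofReal_mul_I_sub_le _ _).trans (hS ω)
    · simp
  all_goals
    refine Integrable.of_bound (C := b) (by fun_prop) (ae_of_all _ fun ω => ?_)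
    rw [norm_mul, Complex.norm_exp_ofReal_mul_I, mul_one]
    exact hη ω

/-- Expansion of `E[ξ_i exp (i t S)]`, `S = ∑ ξ_k`, to first order in the neighbours of `i`. -/
lemma norm_integral_mul_exp_sub_le (hm : ∀ i, Measurable (ξ i)) (hb : ∀ i ω, |ξ i ω| ≤ a)
    (ha : 0 ≤ a) (hmean : ∀ i, ∫ ω, ξ i ω ∂P = 0) (hD : ∀ i, (nb i).card ≤ D)
    (hind : HasDependencyNeighborhoods ξ P nb) (i : ι) (t : ℝ) :
    ‖∫ ω, ξ i ω * Complex.exp ((t * ∑ k, ξ k ω : ℝ) * Complex.I) ∂P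
        - t * Complex.I * (∑ j ∈ nb i, ∫ ω, ξ i ω * ξ j ω ∂P : ℝ)
          * ∫ ω, Complex.exp ((t * ∑ k, ξ k ω : ℝ) * Complex.I) ∂P‖
      ≤ 6 * D ^ 2 * a ^ 3 * t ^ 2 := by
  -- `e'` omits the neighbours of `i`, so that `E[ξ_i e'] = 0`
  set e : Ω → ℂ := fun ω => Complex.exp ((t * ∑ k, ξ k ω : ℝ) * Complex.I) with he
  set e' : Ω → ℂ := fun ω => Complex.exp ((t * ∑ k ∈ (nb i)ᶜ, ξ k ω : ℝ) * Complex.I) with he'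
  have hem : Measurable e := by fun_prop
  have hem' : Measurable e' := by fun_prop
  have hen (ω) : ‖e ω‖ = 1 := Complex.norm_exp_ofReal_mul_I _
  have hen' (ω) : ‖e' ω‖ = 1 := Complex.norm_exp_ofReal_mul_I _
  have hint1 (F : Ω → ℝ) (hF : Measurable F) (b : ℝ) (hFb : ∀ ω, |F ω| ≤ b) :
      Integrable (fun ω => (F ω : ℂ) * e ω) P := by
    refine Integrable.of_bound (C := b) (by fun_prop) (ae_of_all _ fun ω => ?_)
    simpa [hen] using hFb ω
  have hbb (j ω) : |ξ i ω * ξ j ω| ≤ a ^ 2 := by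
    rw [abs_mul, sq]
    exact mul_le_mul (hb _ _) (hb _ _) (abs_nonneg _) ha
  set c : ι → ℝ := fun j => ∫ ω, ξ i ω * ξ j ω ∂P with hc
  have hca (j) : |c j| ≤ a ^ 2 := by
    simpa using norm_integral_le_of_norm_le_const (μ := P) (f := fun ω => ξ i ω * ξ j ω)
      (C := a ^ 2) (ae_of_all _ fun ω => hbb j ω)
  have hcov (j) (hj : j ∈ nb i) : ‖∫ ω, ((ξ i ω * ξ j ω - c j : ℝ) : ℂ) * e ω ∂P‖
      ≤ 4 * D * a ^ 3 * |t| := by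
    have hcard : (({i, j} : Finset ι).biUnion nb).card ≤ 2 * D := by
      rw [Finset.biUnion_insert, Finset.singleton_biUnion, two_mul]
      exact (Finset.card_union_le _ _).trans (add_le_add (hD _) (hD _))
    have := norm_integral_mul_exp_le (P := P) hm hb ha hind {i, j} hcard
      (h := fun x => ((x ⟨i, by simp⟩ * x ⟨j, by simp⟩ - c j : ℝ) : ℂ)) (by fun_prop)
      (b := 2 * a ^ 2) (fun ω => ?_) ?_ t
    · refine this.trans (le_of_eq ?_)
      push_cast
      ring
    · rw [Complex.norm_real, Real.norm_eq_abs]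
      refine (abs_sub _ _).trans ?_
      linarith [hbb j ω, hca j]
    · rw [integral_complex_ofReal, integral_sub, integral_const]
      · simp [hc]
      · exact Integrable.of_bound (C := a ^ 2) (by fun_prop) (ae_of_all _ fun ω => hbb j ω)
      · exact integrable_const _
  have hz : ∫ ω, (ξ i ω : ℂ) * e' ω ∂P = 0 := by
    have := integral_mul_exp_sum_compl_eq_zero (P := P) hm hind {i}
      (h := fun x => (x ⟨i, by simp⟩ : ℂ)) (by fun_prop)
      (by simp only [integral_complex_ofReal, hmean]; simp) t
    simpa [he'] using this
  have hrem : ‖∫ ω, ((ξ i ω : ℂ) * e ω - (ξ i ω : ℂ) * e' ω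
      - t * Complex.I * ∑ j ∈ nb i, ((ξ i ω * ξ j ω : ℝ) : ℂ) * e ω) ∂P‖
      ≤ 2 * D ^ 2 * a ^ 3 * t ^ 2 := by
    refine (norm_integral_le_of_norm_le_const (C := 2 * D ^ 2 * a ^ 3 * t ^ 2)
      (ae_of_all _ fun ω => ?_)).trans (by simp)
    set R := ∑ j ∈ nb i, ξ j ω with hR
    have h1 : e' ω = e ω * Complex.exp ((-(t * R) : ℝ) * Complex.I) := by
      simp only [he, he', ← Complex.exp_add, ← add_mul, ← Complex.ofReal_add, hR]
      rw [← Finset.sum_add_sum_compl (nb i)]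
      congr 3
      ring
    have h2 : ∑ j ∈ nb i, ((ξ i ω * ξ j ω : ℝ) : ℂ) * e ω = ξ i ω * R * e ω := by
      rw [hR, ← Finset.sum_mul, ← Complex.ofReal_sum, ← Finset.mul_sum]
      push_cast
      ring
    have h3 : (ξ i ω : ℂ) * e ω - (ξ i ω : ℂ) * e' ω
        - t * Complex.I * ∑ j ∈ nb i, ((ξ i ω * ξ j ω : ℝ) : ℂ) * e ω
        = -(ξ i ω : ℂ) * e ω * (Complex.exp ((-(t * R) : ℝ) * Complex.I) - 1
          - (-(t * R) : ℝ) * Complex.I) := by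
      rw [h1, h2]
      push_cast
      ring
    rw [h3, norm_mul, norm_mul, hen, norm_neg, Complex.norm_real, mul_one]
    have h4 := norm_exp_ofReal_mul_I_sub_one_sub_le (-(t * R))
    have h5 : R ^ 2 ≤ (D * a) ^ 2 := by
      rw [← sq_abs]
      gcongr
      exact abs_sum_le_card_mul hb ha (hD i) ω
    calc _ ≤ a * (2 * (t ^ 2 * (D * a) ^ 2)) := by
          gcongr
          · exact hb i ω
          · refine h4.trans ?_
            rw [neg_sq, mul_pow]
            gcongr
      _ = _ := by ring
  have hI1 : Integrable (fun ω => (ξ i ω : ℂ) * e ω) P := hint1 _ (hm i) a (hb i)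
  have hI2 : Integrable (fun ω => (ξ i ω : ℂ) * e' ω) P := by
    refine Integrable.of_bound (C := a) (by fun_prop) (ae_of_all _ fun ω => ?_)
    simpa [hen'] using hb i ω
  have hI3 (j) : Integrable (fun ω => ((ξ i ω * ξ j ω : ℝ) : ℂ) * e ω) P :=
    hint1 (fun ω => ξ i ω * ξ j ω) (by fun_prop) (a ^ 2) (hbb j)
  have hI4 : Integrable e P :=
    Integrable.of_bound (C := 1) (by fun_prop) (ae_of_all _ fun ω => (hen ω).le)
  have hI12 : Integrable (fun ω => (ξ i ω : ℂ) * e ω - (ξ i ω : ℂ) * e' ω) P := hI1.sub hI2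
  rw [integral_sub hI12 ((integrable_finsetSum _ fun j _ => hI3 j).const_mul _),
    integral_sub hI1 hI2, hz, sub_zero, integral_const_mul,
    integral_finsetSum _ fun j _ => hI3 j] at hrem
  have hcov' (j) : ∫ ω, ((ξ i ω * ξ j ω - c j : ℝ) : ℂ) * e ω ∂P
      = ∫ ω, ((ξ i ω * ξ j ω : ℝ) : ℂ) * e ω ∂P - c j * ∫ ω, e ω ∂P := by
    rw [← integral_const_mul, ← integral_sub (hI3 j) (hI4.const_mul _)]
    congr 1
    ext ω
    push_cast
    ring
  have hsum : ‖t * Complex.I * ∑ j ∈ nb i, ∫ ω, ((ξ i ω * ξ j ω - c j : ℝ) : ℂ) * e ω ∂P‖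
      ≤ 4 * D ^ 2 * a ^ 3 * t ^ 2 := by
    rw [norm_mul, norm_mul, Complex.norm_I, mul_one, Complex.norm_real, Real.norm_eq_abs]
    calc _ ≤ |t| * ∑ j ∈ nb i, 4 * D * a ^ 3 * |t| := by
          gcongr
          exact norm_sum_le_of_le _ hcov
      _ ≤ |t| * (D * (4 * D * a ^ 3 * |t|)) := by
          rw [Finset.sum_const, nsmul_eq_mul]
          gcongr
          exact hD i
      _ = 4 * D ^ 2 * a ^ 3 * |t| ^ 2 := by ring
      _ = _ := by rw [sq_abs]
  have hsplit : ∫ ω, (ξ i ω : ℂ) * e ω ∂P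
        - t * Complex.I * (∑ j ∈ nb i, c j : ℝ) * ∫ ω, e ω ∂P
      = (∫ ω, (ξ i ω : ℂ) * e ω ∂P
          - t * Complex.I * ∑ j ∈ nb i, ∫ ω, ((ξ i ω * ξ j ω : ℝ) : ℂ) * e ω ∂P)
        + t * Complex.I * ∑ j ∈ nb i, ∫ ω, ((ξ i ω * ξ j ω - c j : ℝ) : ℂ) * e ω ∂P := by
    simp only [hcov', Finset.sum_sub_distrib, ← Finset.sum_mul]
    push_cast
    ring
  rw [hsplit]
  refine (norm_add_le _ _).trans ((add_le_add hrem hsum).trans (le_of_eq ?_))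
  ring

/-- Tikhomirov's form of Stein's method: the characteristic function `φ` of a sum `S` of centred
bounded variables with small dependency neighbourhoods nearly solves the equation
`φ'(t) = -v t φ(t)` of the Gaussian law of variance `v`, hence is close to `exp (-v t² / 2)`. -/
theorem norm_integral_exp_sum_sub_exp_le (hm : ∀ i, Measurable (ξ i)) (hb : ∀ i ω, |ξ i ω| ≤ a)
    (ha : 0 ≤ a) (hmean : ∀ i, ∫ ω, ξ i ω ∂P = 0) (hD : ∀ i, (nb i).card ≤ D)
    (hind : HasDependencyNeighborhoods ξ P nb) {v : ℝ}
    (hv : v = ∑ i, ∑ j ∈ nb i, ∫ ω, ξ i ω * ξ j ω ∂P) (hv0 : 0 ≤ v) (t : ℝ) :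
    ‖∫ ω, Complex.exp ((t * ∑ k, ξ k ω : ℝ) * Complex.I) ∂P - Complex.exp (-(v * t ^ 2 / 2 : ℝ))‖
      ≤ 6 * Fintype.card ι * D ^ 2 * a ^ 3 * |t| ^ 3 * Real.exp (v * t ^ 2 / 2) := by
  set Φ : ℝ → ℂ := fun s => ∫ ω, Complex.exp ((s * ∑ k, ξ k ω : ℝ) * Complex.I) ∂P with hΦ
  set Φ' : ℝ → ℂ := fun s => ∫ ω, ((∑ k, ξ k ω : ℝ) * Complex.I) *
    Complex.exp ((s * ∑ k, ξ k ω : ℝ) * Complex.I) ∂P with hΦ'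
  have hder (s) : HasDerivAt Φ (Φ' s) s :=
    hasDerivAt_integral_exp_mul_I (P := P) (S := fun ω => ∑ k, ξ k ω) (by fun_prop)
      (fun ω => abs_sum_le_card_mul hb ha (Finset.card_univ (α := ι)).le ω) s
  have hode (s) : ‖Φ' s + s * v * Φ s‖ ≤ 6 * Fintype.card ι * D ^ 2 * a ^ 3 * s ^ 2 := by
    have h1 : Φ' s + s * v * Φ s = Complex.I * ∑ i,
        (∫ ω, ξ i ω * Complex.exp ((s * ∑ k, ξ k ω : ℝ) * Complex.I) ∂P
        - s * Complex.I * (∑ j ∈ nb i, ∫ ω, ξ i ω * ξ j ω ∂P : ℝ) * Φ s) := by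
      have h2 : Φ' s = Complex.I *
          ∑ i, ∫ ω, ξ i ω * Complex.exp ((s * ∑ k, ξ k ω : ℝ) * Complex.I) ∂P := by
        rw [← integral_finsetSum, ← integral_const_mul]
        · simp only [hΦ']
          congr 1
          ext ω
          rw [← Finset.sum_mul]
          push_cast
          ring
        · intro i _
          refine Integrable.of_bound (C := a) (by fun_prop) (ae_of_all _ fun ω => ?_)
          rw [norm_mul, Complex.norm_exp_ofReal_mul_I, mul_one]
          simpa using hb i ω
      rw [Finset.sum_sub_distrib, ← Finset.sum_mul, ← Finset.mul_sum, ← Complex.ofReal_sum, ← hv,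
        h2, mul_sub]
      linear_combination ((s : ℂ) * v * Φ s) * Complex.I_mul_I
    rw [h1, norm_mul, Complex.norm_I, one_mul]
    refine (norm_sum_le_of_le _ fun i _ =>
      norm_integral_mul_exp_sub_le hm hb ha hmean hD hind i s).trans (le_of_eq ?_)
    rw [Finset.sum_const, Finset.card_univ, nsmul_eq_mul]
    ring
  -- the derivative of `s ↦ φ(s) exp (v s² / 2)` is small
  set ψ : ℝ → ℂ := fun s => Φ s * Complex.exp ((v * s ^ 2 / 2 : ℝ)) with hψ
  have hψd (s) : HasDerivAt ψ ((Φ' s + s * v * Φ s) * Complex.exp ((v * s ^ 2 / 2 : ℝ))) s := by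
    have h1 : HasDerivAt (fun s : ℝ => ((v * s ^ 2 / 2 : ℝ) : ℂ)) ((v * s : ℝ) : ℂ) s := by
      have : HasDerivAt (fun s : ℝ => v * s ^ 2 / 2) (v * s) s := by
        have := ((hasDerivAt_pow 2 s).const_mul v).div_const 2
        refine this.congr_deriv ?_
        push_cast
        ring
      exact this.ofReal_comp
    refine ((hder s).mul h1.cexp).congr_deriv ?_
    push_cast
    ring
  have hψb (s) (hs : s ∈ Set.Icc (-|t|) |t|) :
      ‖(Φ' s + s * v * Φ s) * Complex.exp ((v * s ^ 2 / 2 : ℝ))‖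
        ≤ 6 * Fintype.card ι * D ^ 2 * a ^ 3 * t ^ 2 * Real.exp (v * t ^ 2 / 2) := by
    have hst : s ^ 2 ≤ t ^ 2 := sq_le_sq.2 (abs_le.2 hs)
    rw [norm_mul, ← Complex.ofReal_exp, Complex.norm_real, Real.norm_eq_abs, Real.abs_exp]
    gcongr
    exact (hode s).trans (by gcongr)
  have hψ0 : ψ 0 = 1 := by simp [hψ, hΦ]
  have hfin : ‖ψ t - ψ 0‖ ≤
      6 * Fintype.card ι * D ^ 2 * a ^ 3 * t ^ 2 * Real.exp (v * t ^ 2 / 2) * ‖t - 0‖ :=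
    (convex_Icc _ _).norm_image_sub_le_of_norm_hasDerivWithin_le
      (fun s _ => (hψd s).hasDerivWithinAt) hψb
      ⟨by simp, by simp⟩ ⟨neg_abs_le t, le_abs_self t⟩
  have hfac : Φ t - Complex.exp (-(v * t ^ 2 / 2 : ℝ))
      = Complex.exp (-(v * t ^ 2 / 2 : ℝ)) * (ψ t - ψ 0) := by
    have : Complex.exp (-(v * t ^ 2 / 2 : ℝ)) * Complex.exp ((v * t ^ 2 / 2 : ℝ)) = 1 := by
      rw [← Complex.exp_add]
      simp
    rw [hψ0, mul_sub, mul_one]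
    simp only [hψ]
    linear_combination (-Φ t) * this
  rw [hfac, norm_mul]
  have hle : ‖Complex.exp (-(v * t ^ 2 / 2 : ℝ))‖ ≤ 1 := by
    rw [← Complex.ofReal_neg, ← Complex.ofReal_exp, Complex.norm_real, Real.norm_eq_abs,
      Real.abs_exp, Real.exp_le_one_iff]
    have := mul_nonneg hv0 (sq_nonneg t)
    linarith
  calc _ ≤ 1 * (6 * Fintype.card ι * D ^ 2 * a ^ 3 * t ^ 2 * Real.exp (v * t ^ 2 / 2) * ‖t - 0‖) :=
        mul_le_mul hle hfin (norm_nonneg _) zero_le_one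
    _ = 6 * Fintype.card ι * D ^ 2 * a ^ 3 * (|t| ^ 2 * |t|) * Real.exp (v * t ^ 2 / 2) := by
      rw [sub_zero, Real.norm_eq_abs, sq_abs]
      ring
    _ = _ := by ring

end LocalDependence

namespace AlphaSMC

/-! ### The weighted particles as a Markov chain with local transitions -/

section Chain

variable {X : Type*} [MeasurableSpace X] {ι : Type*} [Fintype ι]

/-- The weight `∑_j α^{ij} w_j γ(x_j)` that particle `i` receives from the weighted particles
`y_j = (w_j, x_j)`. -/
def nextWeight (α : Matrix ι ι ℝ) (γ : X → ℝ) (y : ι → ℝ × X) (i : ι) : ℝ :=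
  ∑ j, α i j * (y j).1 * γ (y j).2

/-- The law `∑_j α^{ij} w_j γ(x_j) f(x_j, ·) / ∑_j α^{ij} w_j γ(x_j)` of the next position of
particle `i`, given the weighted particles `y_j = (w_j, x_j)`. It is extended by `π₀` to the
configurations, never visited, where the denominator vanishes, so that it is always a
probability measure. -/
def nextLaw (π₀ : Measure X) (α : Matrix ι ι ℝ) (γ : X → ℝ) (f : Kernel X X)
    (y : ι → ℝ × X) (i : ι) : Measure X :=
  open scoped Classical in
  if ∑ j, ENNReal.ofReal (α i j * (y j).1 * γ (y j).2) = 0 then π₀ else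
    (∑ j, ENNReal.ofReal (α i j * (y j).1 * γ (y j).2))⁻¹ •
      ∑ j, ENNReal.ofReal (α i j * (y j).1 * γ (y j).2) • f (y j).2

variable {π₀ : Measure X} {α : Matrix ι ι ℝ} {γ : X → ℝ} {f : Kernel X X}

lemma measurable_nextWeight (hγ : Measurable γ) (i : ι) :
    Measurable fun y : ι → ℝ × X => nextWeight α γ y i := by
  unfold nextWeight
  fun_prop

instance [IsProbabilityMeasure π₀] [IsMarkovKernel f] (y : ι → ℝ × X) (i : ι) :
    IsProbabilityMeasure (nextLaw π₀ α γ f y i) := by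
  unfold nextLaw
  split_ifs with h
  · infer_instance
  · constructor
    simp only [Measure.smul_apply, Measure.coe_finsetSum, Finset.sum_apply, measure_univ,
      smul_eq_mul, mul_one]
    exact ENNReal.inv_mul_cancel h (ENNReal.sum_ne_top.2 fun _ _ => ENNReal.ofReal_ne_top)

lemma measurable_nextLaw (hγ : Measurable γ) (i : ι) :
    Measurable fun y : ι → ℝ × X => nextLaw π₀ α γ f y i := by
  unfold nextLaw
  have h1 : Measurable fun y : ι → ℝ × X =>
      ∑ j, ENNReal.ofReal (α i j * (y j).1 * γ (y j).2) := by fun_prop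
  refine Measurable.ite (h1 (measurableSet_singleton 0)) measurable_const ?_
  refine Measure.measurable_of_measurable_coe _ fun s hs => ?_
  simp only [Measure.smul_apply, Measure.coe_finsetSum, Finset.sum_apply, smul_eq_mul]
  have h2 (j : ι) : Measurable fun y : ι → ℝ × X => f (y j).2 s :=
    (Kernel.measurable_coe f hs).comp (by fun_prop)
  exact h1.inv.mul (Finset.measurable_fun_sum _ fun j _ => Measurable.mul (by fun_prop) (h2 j))

/-- `nextLaw` for positive weights. -/
lemma nextLaw_eq {y : ι → ℝ × X} {i : ι} (hnn : ∀ j, 0 ≤ α i j * (y j).1 * γ (y j).2)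
    (hpos : 0 < nextWeight α γ y i) :
    nextLaw π₀ α γ f y i = (ENNReal.ofReal (nextWeight α γ y i))⁻¹ •
      ∑ j, ENNReal.ofReal (α i j * (y j).1 * γ (y j).2) • f (y j).2 := by
  have h : ∑ j, ENNReal.ofReal (α i j * (y j).1 * γ (y j).2)
      = ENNReal.ofReal (nextWeight α γ y i) :=
    (ENNReal.ofReal_sum_of_nonneg fun j _ => hnn j).symm
  unfold nextLaw
  rw [h, if_neg (ENNReal.ofReal_pos.2 hpos).ne']

variable (π₀ α γ f) in
/-- The particles move independently of each other, given the current configuration. -/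
def stepKernel [IsProbabilityMeasure π₀] [IsMarkovKernel f] (hγ : Measurable γ) :
    Kernel (ι → ℝ × X) (ι → X) where
  toFun y := Measure.pi fun i => nextLaw π₀ α γ f y i
  measurable' := by
    refine Measurable.measure_of_isPiSystem_of_isProbabilityMeasure generateFrom_pi.symm
      isPiSystem_pi ?_
    rintro _ ⟨s, hs, rfl⟩
    simp only [Measure.pi_pi]
    exact Finset.measurable_prod _ fun i _ =>
      (Measure.measurable_coe (hs i trivial)).comp (measurable_nextLaw hγ i)

lemma stepKernel_apply [IsProbabilityMeasure π₀] [IsMarkovKernel f] (hγ : Measurable γ)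
    (y : ι → ℝ × X) :
    stepKernel π₀ α γ f hγ y = Measure.pi fun i => nextLaw π₀ α γ f y i := rfl

instance [IsProbabilityMeasure π₀] [IsMarkovKernel f] (hγ : Measurable γ) :
    IsMarkovKernel (stepKernel π₀ α γ f hγ) :=
  ⟨fun y => by rw [stepKernel_apply]; infer_instance⟩

variable {g : ℕ → X → ℝ}

section Weights

variable (hg_pos : ∀ n x, 0 < g n x) (hα0 : ∀ i j, 0 ≤ α i j) (hα1 : ∀ i, ∑ j, α i j = 1)
include hg_pos hα0 hα1

lemma weight_pos (z : ℕ → ι → X) (n : ℕ) (i : ι) : 0 < weight α g z n i := by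
  induction n generalizing i with
  | zero => simp [weight]
  | succ n ih =>
    obtain ⟨j, hj⟩ : ∃ j, 0 < α i j := by
      by_contra! h
      have := Finset.sum_nonpos fun j (_ : j ∈ Finset.univ) => h j
      linarith [hα1 i]
    exact Finset.sum_pos' (fun k _ => mul_nonneg (mul_nonneg (hα0 i k) (ih k).le) (hg_pos n _).le)
      ⟨j, Finset.mem_univ j, mul_pos (mul_pos hj (ih j)) (hg_pos n _)⟩

lemma weight_le {C : ℕ → ℝ} (hC : ∀ n x, g n x ≤ C n) (z : ℕ → ι → X) (n : ℕ) (i : ι) :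
    weight α g z n i ≤ ∏ k ∈ Finset.range n, C k := by
  induction n generalizing i with
  | zero => simp [weight]
  | succ n ih =>
    rw [Finset.prod_range_succ]
    calc weight α g z (n + 1) i ≤ ∑ j, α i j * ((∏ k ∈ Finset.range n, C k) * C n) := by
          refine Finset.sum_le_sum fun j _ => ?_
          rw [mul_assoc]
          exact mul_le_mul_of_nonneg_left (mul_le_mul (ih j) (hC n _) (hg_pos n _).le
            ((weight_pos hg_pos hα0 hα1 z n j).le.trans (ih j))) (hα0 i j)
      _ = _ := by rw [← Finset.sum_mul, hα1, one_mul]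

end Weights

variable {Ω : Type*} [MeasurableSpace Ω] {P : Measure Ω} {ζ : ℕ → ι → Ω → X}

/-- The weighted particles `(W_n^i, ζ_n^i)`, `i ∈ ι`, at time `n`. -/
def state (α : Matrix ι ι ℝ) (g : ℕ → X → ℝ) (ζ : ℕ → ι → Ω → X) (n : ℕ) (ω : Ω) : ι → ℝ × X :=
  fun i => (weight α g (fun k j => ζ k j ω) n i, ζ n i ω)

lemma measurable_history (ζ : ℕ → ι → Ω → X) {k n : ℕ} (hk : k ≤ n) (i : ι) :
    Measurable[history ζ n] (ζ k i) := by
  have : MeasurableSpace.comap (ζ k i) inferInstance ≤ history ζ n :=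
    (le_iSup (fun i => MeasurableSpace.comap (ζ k i) inferInstance) i).trans
      (le_iSup₂ (f := fun k (_ : k ∈ Set.Iic n) =>
        ⨆ i, MeasurableSpace.comap (ζ k i) inferInstance) k hk)
  exact (comap_measurable _).mono this le_rfl

lemma measurable_weight_history (hg : ∀ n, Measurable (g n)) {k n : ℕ} (hk : k ≤ n) (i : ι) :
    Measurable[history ζ n] fun ω => weight α g (fun k j => ζ k j ω) k i := by
  induction k generalizing i with
  | zero => exact measurable_const
  | succ k ih =>
    refine Finset.measurable_fun_sum _ fun j _ => ?_
    exact ((ih (by omega) j).const_mul _).mul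
      ((hg k).comp (measurable_history ζ (by omega) j))

lemma measurable_state_history (hg : ∀ n, Measurable (g n)) (n : ℕ) :
    Measurable[history ζ n] (state α g ζ n) :=
  @measurable_pi_lambda Ω ι (fun _ => ℝ × X) (history ζ n) _ _ fun i =>
    (measurable_weight_history hg le_rfl i).prodMk (measurable_history ζ le_rfl i)

lemma IsParticleSystem.history_le {κ : ℕ → ι → (ℕ → ι → X) → Set X → ℝ}
    (hS : IsParticleSystem π₀ κ P ζ) (n : ℕ) : history ζ n ≤ ‹MeasurableSpace Ω› :=
  iSup₂_le fun k _ => iSup_le fun i => (hS.measurable k i).comap_le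

lemma IsParticleSystem.measurable_state {κ : ℕ → ι → (ℕ → ι → X) → Set X → ℝ}
    (hS : IsParticleSystem π₀ κ P ζ) (hg : ∀ n, Measurable (g n)) (n : ℕ) :
    Measurable (state α g ζ n) :=
  (measurable_state_history hg n).mono (hS.history_le n) le_rfl

variable [IsProbabilityMeasure π₀] [IsMarkovKernel f]

lemma nextLaw_state_apply (hg_pos : ∀ n x, 0 < g n x) (hα0 : ∀ i j, 0 ≤ α i j)
    (hα1 : ∀ i, ∑ j, α i j = 1) (n : ℕ) (ω : Ω) (i : ι) (A : Set X) :
    nextLaw π₀ α (g n) f (state α g ζ n ω) i A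
      = ENNReal.ofReal (sampling α f g n i (fun k j => ζ k j ω) A) := by
  have hpos := weight_pos hg_pos hα0 hα1 (fun k j => ζ k j ω)
  have hnn (j) : 0 ≤ α i j * weight α g (fun k j => ζ k j ω) n j * g n (ζ n j ω) :=
    mul_nonneg (mul_nonneg (hα0 i j) (hpos n j).le) (hg_pos n _).le
  have hw : 0 < nextWeight α (g n) (state α g ζ n ω) i := hpos (n + 1) i
  rw [nextLaw_eq (y := state α g ζ n ω) hnn hw, sampling,
    ENNReal.ofReal_mul (inv_nonneg.2 (hpos _ _).le), ENNReal.ofReal_inv_of_pos (hpos _ _),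
    ENNReal.ofReal_sum_of_nonneg fun j _ => mul_nonneg (hnn j) measureReal_nonneg]
  simp only [Measure.smul_apply, Measure.coe_finsetSum, Finset.sum_apply, smul_eq_mul]
  congr 1
  refine Finset.sum_congr rfl fun j _ => ?_
  rw [ENNReal.ofReal_mul (hnn j), ofReal_measureReal]
  rfl

/-- The Markov property: the conditional law of `ζ_{n+1}` only depends on the current weighted
particles. -/
theorem IsParticleSystem.map_state_prodMk [IsProbabilityMeasure P]
    (hS : IsParticleSystem π₀ (sampling α f g) P ζ)
    (hg : ∀ n, Measurable (g n)) (hg_pos : ∀ n x, 0 < g n x) (hα0 : ∀ i j, 0 ≤ α i j)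
    (hα1 : ∀ i, ∑ j, α i j = 1) (n : ℕ) :
    P.map (fun ω => (state α g ζ n ω, fun i => ζ (n + 1) i ω))
      = (P.map (state α g ζ n)) ⊗ₘ stepKernel π₀ α (g n) f (hg n) := by
  have hY : Measurable (state α g ζ n) := hS.measurable_state hg n
  have hZ : Measurable fun ω i => ζ (n + 1) i ω :=
    measurable_pi_lambda _ fun i => hS.measurable (n + 1) i
  have := Measure.isProbabilityMeasure_map hY.aemeasurable (μ := P)
  have := Measure.isProbabilityMeasure_map (hY.prodMk hZ).aemeasurable (μ := P)
  refine Measure.ext_prod fun {B C} hB hC => ?_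
  rw [Measure.compProd_apply_prod hB hC, Measure.map_apply (hY.prodMk hZ) (hB.prod hC),
    setLIntegral_map hB (Kernel.measurable_coe _ hC) hY]
  -- for fixed `B`, both sides are finite measures in `C`; it suffices to compare them on boxes
  set ν₁ := (P.restrict (state α g ζ n ⁻¹' B)).map fun ω i => ζ (n + 1) i ω with hν₁
  set ν₂ := ((P.restrict (state α g ζ n ⁻¹' B)).map (state α g ζ n)).bind
    (stepKernel π₀ α (g n) f (hg n)) with hν₂
  have h1 (C : Set (ι → X)) (hC : MeasurableSet C) :
      P ((fun ω => (state α g ζ n ω, fun i => ζ (n + 1) i ω)) ⁻¹' B ×ˢ C) = ν₁ C := by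
    rw [hν₁, Measure.map_apply hZ hC, Measure.restrict_apply (hZ hC), Set.inter_comm]
    rfl
  have h2 (C : Set (ι → X)) (hC : MeasurableSet C) :
      ∫⁻ ω in state α g ζ n ⁻¹' B, stepKernel π₀ α (g n) f (hg n) (state α g ζ n ω) C ∂P = ν₂ C := by
    rw [hν₂, Measure.bind_apply hC (Kernel.aemeasurable _),
      lintegral_map (Kernel.measurable_coe _ hC) hY]
  rw [h1 C hC, h2 C hC]
  have hbox (A : ι → Set X) (hA : ∀ i, MeasurableSet (A i)) :
      ν₁ (Set.univ.pi A) = ν₂ (Set.univ.pi A) := by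
    have hAm : MeasurableSet (Set.univ.pi A) := MeasurableSet.univ_pi hA
    have hE : MeasurableSet {ω | ∀ i, ζ (n + 1) i ω ∈ A i} := by
      convert hZ hAm using 1
      ext ω
      simp
    have hBh : MeasurableSet[history ζ n] (state α g ζ n ⁻¹' B) :=
      measurable_state_history hg n hB
    have hset : ∫ ω in state α g ζ n ⁻¹' B,
        ∏ i, sampling α f g n i (fun k j => ζ k j ω) (A i) ∂P
        = P.real (state α g ζ n ⁻¹' B ∩ {ω | ∀ i, ζ (n + 1) i ω ∈ A i}) := by
      rw [← integral_congr_ae (ae_restrict_of_ae (hS.cond_law n A hA)),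
        setIntegral_condExp (hS.history_le n) ((integrable_const 1).indicator hE) hBh,
        integral_indicator hE, Measure.restrict_restrict hE, setIntegral_const]
      simp [Set.inter_comm]
    have hnn (ω) (i) : 0 ≤ sampling α f g n i (fun k j => ζ k j ω) (A i) := by
      have hpos := weight_pos hg_pos hα0 hα1 (fun k j => ζ k j ω)
      refine mul_nonneg (inv_nonneg.2 (hpos _ _).le) (Finset.sum_nonneg fun j _ => ?_)
      exact mul_nonneg (mul_nonneg (mul_nonneg (hα0 i j) (hpos n j).le) (hg_pos n _).le)
        measureReal_nonneg
    have hint : Integrable (fun ω => ∏ i, sampling α f g n i (fun k j => ζ k j ω) (A i)) P :=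
      integrable_condExp.congr (hS.cond_law n A hA)
    rw [← h1 _ hAm, ← h2 _ hAm]
    have h3 (ω) : stepKernel π₀ α (g n) f (hg n) (state α g ζ n ω) (Set.univ.pi A)
        = ENNReal.ofReal (∏ i, sampling α f g n i (fun k j => ζ k j ω) (A i)) := by
      rw [stepKernel_apply, Measure.pi_pi, ENNReal.ofReal_prod_of_nonneg fun i _ => hnn ω i]
      simp only [nextLaw_state_apply hg_pos hα0 hα1]
    simp only [h3]
    rw [← ofReal_integral_eq_lintegral_ofReal hint.integrableOn
      (ae_of_all _ fun ω => Finset.prod_nonneg fun i _ => hnn ω i), hset, ofReal_measureReal]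
    congr 1
    ext ω
    simp
  have huniv := hbox (fun _ => Set.univ) fun _ => MeasurableSet.univ
  rw [Set.pi_univ] at huniv
  have : ν₁ = ν₂ := by
    refine ext_of_generate_finite _ generateFrom_pi.symm isPiSystem_pi ?_ huniv
    rintro _ ⟨A, hA, rfl⟩
    exact hbox A fun i => hA i trivial
  rw [this]

end Chain

/-! ### Independence of distant particles -/

section Product

variable {X : Type*} [MeasurableSpace X] {ι : Type*} [Fintype ι]

lemma exists_measurable_eq_comp_restrict {F : (ι → X) → ENNReal} (hF : Measurable F)
    {A : Finset ι} (hA : DependsOn F (A : Set ι)) (x₀ : ι → X) :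
    ∃ F' : (A → X) → ENNReal, Measurable F' ∧ ∀ x, F x = F' fun k => x k := by
  classical
  refine ⟨fun z => F fun i => if h : i ∈ A then z ⟨i, h⟩ else x₀ i, hF.comp ?_, fun x => ?_⟩
  · refine measurable_pi_lambda _ fun i => ?_
    by_cases h : i ∈ A
    · simpa [h] using measurable_pi_apply _
    · simp [h]
  · refine hA fun i hi => ?_
    simp [Finset.mem_coe.1 hi]

variable {μ ν : ι → Measure X} [∀ i, IsProbabilityMeasure (μ i)] [∀ i, IsProbabilityMeasure (ν i)]

lemma lintegral_pi_mul_of_disjoint {F G : (ι → X) → ENNReal} (hF : Measurable F)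
    (hG : Measurable G) {A B : Finset ι} (hA : DependsOn F (A : Set ι))
    (hB : DependsOn G (B : Set ι)) (hAB : Disjoint A B) :
    ∫⁻ x, F x * G x ∂Measure.pi μ = (∫⁻ x, F x ∂Measure.pi μ) * ∫⁻ x, G x ∂Measure.pi μ := by
  obtain ⟨x₀⟩ := nonempty_of_isProbabilityMeasure (Measure.pi μ)
  obtain ⟨F', hF', hFF'⟩ := exists_measurable_eq_comp_restrict hF hA x₀
  obtain ⟨G', hG', hGG'⟩ := exists_measurable_eq_comp_restrict hG hB x₀
  have hi : iIndepFun (fun i (x : ι → X) => x i) (Measure.pi μ) :=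
    iIndepFun_pi (X := fun _ x => x) fun i => aemeasurable_id
  have h := (hi.indepFun_finset A B hAB fun i => measurable_pi_apply i).comp hF' hG'
  have h2 := lintegral_mul_eq_lintegral_mul_lintegral_of_indepFun
    (hF'.comp (by fun_prop)) (hG'.comp (by fun_prop)) h
  simpa only [Function.comp_def, Pi.mul_apply, ← hFF', ← hGG'] using h2

/-- The integral of a function of the coordinates in `A` only depends on the factors of the product
measure which belong to `A`. -/
lemma lintegral_pi_congr {F : (ι → X) → ENNReal} (hF : Measurable F) {A : Finset ι}
    (hA : DependsOn F (A : Set ι)) (h : ∀ i ∈ A, μ i = ν i) :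
    ∫⁻ x, F x ∂Measure.pi μ = ∫⁻ x, F x ∂Measure.pi ν := by
  obtain ⟨x₀⟩ := nonempty_of_isProbabilityMeasure (Measure.pi μ)
  obtain ⟨F', hF', hFF'⟩ := exists_measurable_eq_comp_restrict hF hA x₀
  have key (ρ : ι → Measure X) [∀ i, IsProbabilityMeasure (ρ i)] :
      (Measure.pi ρ).map (fun x (k : A) => x k) = Measure.pi fun k : A => ρ k := by
    have hi : iIndepFun (fun i (x : ι → X) => x i) (Measure.pi ρ) :=
      iIndepFun_pi (X := fun _ x => x) fun i => aemeasurable_id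
    have h1 := (iIndepFun_iff_map_fun_eq_pi_map fun k => (measurable_pi_apply _).aemeasurable).1
      (hi.precomp (g := fun k : A => (k : ι)) Subtype.val_injective)
    rw [h1]
    congr 1
    ext1 k
    exact (measurePreserving_eval ρ k).map_eq
  simp only [hFF']
  have key' (ρ : ι → Measure X) [∀ i, IsProbabilityMeasure (ρ i)] :
      ∫⁻ x, F' (fun k => x k) ∂Measure.pi ρ = ∫⁻ z, F' z ∂Measure.pi fun k : A => ρ k := by
    rw [← key ρ, lintegral_map hF' (by fun_prop)]
  rw [key' μ, key' ν]
  congr 2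
  ext1 k
  exact h k k.2

end Product

section Locality

variable {X : Type*} [MeasurableSpace X] {ι : Type*} [Fintype ι] [DecidableEq ι]

/-- The `k`-th ancestors of the sites in `A`: the weighted particles in `A` at time `n` depend on
the configuration at time `n - k` only through the particles at these sites. -/
def influence (α : Matrix ι ι ℝ) : ℕ → Finset ι → Finset ι
  | 0, A => A
  | k + 1, A => open scoped Classical in influence α k {j | ∃ i ∈ A, α i j ≠ 0}

variable {π₀ : Measure X} {α : Matrix ι ι ℝ} {γ : X → ℝ} {f : Kernel X X}
  [IsProbabilityMeasure π₀] [IsMarkovKernel f]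

variable (π₀ α f) in
/-- The transition operator of the chain of weighted particles. -/
def stepOperator (hγ : Measurable γ) (F : (ι → ℝ × X) → ENNReal) (y : ι → ℝ × X) : ENNReal :=
  ∫⁻ x, F (fun i => (nextWeight α γ y i, x i)) ∂(stepKernel π₀ α γ f hγ y)

lemma measurable_stepOperator (hγ : Measurable γ) {F : (ι → ℝ × X) → ENNReal}
    (hF : Measurable F) : Measurable (stepOperator π₀ α f hγ F) := by
  refine Measurable.lintegral_kernel_prod_right' (κ := stepKernel π₀ α γ f hγ)
    (f := fun p : (ι → ℝ × X) × (ι → X) => F fun i => (nextWeight α γ p.1 i, p.2 i)) ?_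
  refine hF.comp (measurable_pi_lambda _ fun i => ?_)
  exact ((measurable_nextWeight hγ i).comp measurable_fst).prodMk (by fun_prop)

lemma nextWeight_congr {y y' : ι → ℝ × X} {i : ι} (h : ∀ j, α i j ≠ 0 → y j = y' j) :
    nextWeight α γ y i = nextWeight α γ y' i := by
  refine Finset.sum_congr rfl fun j _ => ?_
  by_cases hj : α i j = 0
  · simp [hj]
  · rw [h j hj]

lemma nextLaw_congr {y y' : ι → ℝ × X} {i : ι} (h : ∀ j, α i j ≠ 0 → y j = y' j) :
    nextLaw π₀ α γ f y i = nextLaw π₀ α γ f y' i := by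
  have h1 (j) : ENNReal.ofReal (α i j * (y j).1 * γ (y j).2)
      = ENNReal.ofReal (α i j * (y' j).1 * γ (y' j).2) := by
    by_cases hj : α i j = 0
    · simp [hj]
    · rw [h j hj]
  have h2 (j) : ENNReal.ofReal (α i j * (y' j).1 * γ (y' j).2) • f (y j).2
      = ENNReal.ofReal (α i j * (y' j).1 * γ (y' j).2) • f (y' j).2 := by
    by_cases hj : α i j = 0
    · simp [hj]
    · rw [h j hj]
  simp only [nextLaw, h1, h2]

lemma measurable_weightedConfiguration (w : ι → ℝ) :
    Measurable fun (x : ι → X) (i : ι) => (w i, x i) := by fun_prop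

lemma dependsOn_weightedConfiguration {F : (ι → ℝ × X) → ENNReal} {A : Finset ι}
    (hA : DependsOn F (A : Set ι)) (w : ι → ℝ) :
    DependsOn (fun x : ι → X => F fun i => (w i, x i)) (A : Set ι) :=
  fun x y h => hA fun i hi => by rw [h i hi]

lemma dependsOn_stepOperator (hγ : Measurable γ) {F : (ι → ℝ × X) → ENNReal} (hF : Measurable F)
    {A : Finset ι} (hA : DependsOn F (A : Set ι)) :
    DependsOn (stepOperator π₀ α f hγ F) (influence α 1 A : Set ι) := by
  classical
  intro y y' h
  have h' (i) (hi : i ∈ A) (j) (hj : α i j ≠ 0) : y j = y' j := by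
    refine h j ?_
    simp only [influence, Finset.coe_filter, Finset.mem_univ, true_and, Set.mem_ofPred_eq]
    exact ⟨i, hi, hj⟩
  simp only [stepOperator, stepKernel_apply]
  have h1 (x : ι → X) : F (fun i => (nextWeight α γ y i, x i))
      = F fun i => (nextWeight α γ y' i, x i) :=
    hA fun i hi => by rw [nextWeight_congr (h' i hi)]
  simp only [h1]
  exact lintegral_pi_congr (hF.comp (measurable_weightedConfiguration _))
    (dependsOn_weightedConfiguration hA _) fun i hi => nextLaw_congr (h' i hi)

lemma stepOperator_mul (hγ : Measurable γ) {F G : (ι → ℝ × X) → ENNReal} (hF : Measurable F)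
    (hG : Measurable G) {A B : Finset ι} (hA : DependsOn F (A : Set ι))
    (hB : DependsOn G (B : Set ι)) (hAB : Disjoint A B) (y : ι → ℝ × X) :
    stepOperator π₀ α f hγ (fun y => F y * G y) y
      = stepOperator π₀ α f hγ F y * stepOperator π₀ α f hγ G y :=
  lintegral_pi_mul_of_disjoint (hF.comp (measurable_weightedConfiguration _))
    (hG.comp (measurable_weightedConfiguration _)) (dependsOn_weightedConfiguration hA _)
    (dependsOn_weightedConfiguration hB _) hAB

variable {g : ℕ → X → ℝ} {Ω : Type*} [MeasurableSpace Ω] {P : Measure Ω} [IsProbabilityMeasure P]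
  {ζ : ℕ → ι → Ω → X}

lemma IsParticleSystem.lintegral_state_succ
    (hS : IsParticleSystem π₀ (sampling α f g) P ζ)
    (hg : ∀ n, Measurable (g n)) (hg_pos : ∀ n x, 0 < g n x) (hα0 : ∀ i j, 0 ≤ α i j)
    (hα1 : ∀ i, ∑ j, α i j = 1) (n : ℕ) {F : (ι → ℝ × X) → ENNReal} (hF : Measurable F) :
    ∫⁻ ω, F (state α g ζ (n + 1) ω) ∂P
      = ∫⁻ ω, stepOperator π₀ α f (hg n) F (state α g ζ n ω) ∂P := by
  have hY : Measurable (state α g ζ n) := hS.measurable_state hg n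
  have hZ : Measurable fun ω i => ζ (n + 1) i ω :=
    measurable_pi_lambda _ fun i => hS.measurable (n + 1) i
  have hF' : Measurable fun p : (ι → ℝ × X) × (ι → X) =>
      F fun i => (nextWeight α (g n) p.1 i, p.2 i) := by
    refine hF.comp (measurable_pi_lambda _ fun i => ?_)
    exact ((measurable_nextWeight (hg n) i).comp measurable_fst).prodMk (by fun_prop)
  have h1 := lintegral_map (μ := P) hF' (hY.prodMk hZ)
  rw [hS.map_state_prodMk hg hg_pos hα0 hα1, Measure.lintegral_compProd hF'] at h1
  exact h1.symm.trans (lintegral_map (measurable_stepOperator (hg n) hF) hY)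

lemma IsParticleSystem.map_zero {κ : ℕ → ι → (ℕ → ι → X) → Set X → ℝ}
    (hS : IsParticleSystem π₀ κ P ζ) :
    P.map (fun ω i => ζ 0 i ω) = Measure.pi fun _ => π₀ := by
  rw [(iIndepFun_iff_map_fun_eq_pi_map fun i => (hS.measurable 0 i).aemeasurable).1 hS.indep_zero]
  simp only [hS.law_zero]

/-- Functions of the weighted particles in `A` and in `B` are independent when no site influences
both `A` and `B`: the transition operator respects products of such functions. -/
theorem IsParticleSystem.lintegral_mul_of_disjoint_influence
    (hS : IsParticleSystem π₀ (sampling α f g) P ζ)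
    (hg : ∀ n, Measurable (g n)) (hg_pos : ∀ n x, 0 < g n x) (hα0 : ∀ i j, 0 ≤ α i j)
    (hα1 : ∀ i, ∑ j, α i j = 1) (n : ℕ) {A B : Finset ι}
    (hAB : ∀ k ≤ n, Disjoint (influence α k A) (influence α k B))
    {F G : (ι → ℝ × X) → ENNReal} (hF : Measurable F) (hG : Measurable G)
    (hA : DependsOn F (A : Set ι)) (hB : DependsOn G (B : Set ι)) :
    ∫⁻ ω, F (state α g ζ n ω) * G (state α g ζ n ω) ∂P
      = (∫⁻ ω, F (state α g ζ n ω) ∂P) * ∫⁻ ω, G (state α g ζ n ω) ∂P := by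
  induction n generalizing A B F G with
  | zero =>
    have h (H : (ι → ℝ × X) → ENNReal) (hH : Measurable H) :
        ∫⁻ ω, H (state α g ζ 0 ω) ∂P = ∫⁻ x, H (fun i => (1, x i)) ∂Measure.pi fun _ => π₀ := by
      rw [← hS.map_zero]
      exact (lintegral_map (hH.comp (measurable_weightedConfiguration fun _ => 1))
        (measurable_pi_lambda _ fun i => hS.measurable 0 i)).symm
    rw [h F hF, h G hG, h (fun y => F y * G y) (hF.mul hG)]
    exact lintegral_pi_mul_of_disjoint (hF.comp (measurable_weightedConfiguration _))
      (hG.comp (measurable_weightedConfiguration _)) (dependsOn_weightedConfiguration hA _)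
      (dependsOn_weightedConfiguration hB _) (hAB 0 le_rfl)
  | succ n ih =>
    rw [hS.lintegral_state_succ hg hg_pos hα0 hα1 n hF,
      hS.lintegral_state_succ hg hg_pos hα0 hα1 n hG,
      hS.lintegral_state_succ hg hg_pos hα0 hα1 n (F := fun y => F y * G y) (hF.mul hG)]
    rw [← ih (A := influence α 1 A) (B := influence α 1 B) (fun k hk => hAB (k + 1) (by omega))
      (measurable_stepOperator (hg n) hF) (measurable_stepOperator (hg n) hG)
      (dependsOn_stepOperator (hg n) hF hA) (dependsOn_stepOperator (hg n) hG hB)]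
    congr 1
    ext ω
    exact stepOperator_mul (hg n) hF hG hA hB (hAB 0 (by omega)) _

theorem IsParticleSystem.indepFun_of_disjoint_influence
    (hS : IsParticleSystem π₀ (sampling α f g) P ζ)
    (hg : ∀ n, Measurable (g n)) (hg_pos : ∀ n x, 0 < g n x) (hα0 : ∀ i j, 0 ≤ α i j)
    (hα1 : ∀ i, ∑ j, α i j = 1) (n : ℕ) {A B : Finset ι}
    (hAB : ∀ k ≤ n, Disjoint (influence α k A) (influence α k B))
    {h : ℝ × X → ℝ} (hh : Measurable h) :
    IndepFun (fun ω (k : A) => h (state α g ζ n ω k)) (fun ω (k : B) => h (state α g ζ n ω k))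
      P := by
  have hY : Measurable (state α g ζ n) := hS.measurable_state hg n
  rw [indepFun_iff_measure_inter_preimage_eq_mul]
  intro s t hs ht
  have hm (C : Finset ι) : Measurable fun (y : ι → ℝ × X) (k : C) => h (y k) := by fun_prop
  have hd (C : Finset ι) (u : Set (C → ℝ)) : DependsOn
      (((fun (y : ι → ℝ × X) (k : C) => h (y k)) ⁻¹' u).indicator fun _ => (1 : ENNReal))
      (C : Set ι) := by
    intro y y' hyy
    have : (fun k : C => h (y k)) = fun k : C => h (y' k) := by
      ext k
      rw [hyy k k.2]
    have hmem : y ∈ (fun (y : ι → ℝ × X) (k : C) => h (y k)) ⁻¹' u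
        ↔ y' ∈ (fun (y : ι → ℝ × X) (k : C) => h (y k)) ⁻¹' u := by
      rw [Set.mem_preimage, Set.mem_preimage, this]
    classical
    simp only [Set.indicator_apply, hmem]
  have key := hS.lintegral_mul_of_disjoint_influence hg hg_pos hα0 hα1 n hAB
    (measurable_const.indicator (hm A hs)) (measurable_const.indicator (hm B ht)) (hd A s) (hd B t)
  have e (u : Set (ι → ℝ × X)) (hu : MeasurableSet u) :
      ∫⁻ ω, u.indicator (fun _ => (1 : ENNReal)) (state α g ζ n ω) ∂P
        = P (state α g ζ n ⁻¹' u) := by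
    rw [← lintegral_indicator_one (hY hu)]
    rfl
  rw [e _ (hm A hs), e _ (hm B ht)] at key
  simp only [← Set.inter_indicator_mul, mul_one] at key
  rw [e _ ((hm A hs).inter (hm B ht))] at key
  exact key

end Locality

/-! ### First and second moments of the weighted particles -/

section BoundedMeasurable

/-- Bounded measurable real functions. -/
def BoundedMeasurable {E : Type*} [MeasurableSpace E] (h : E → ℝ) : Prop :=
  Measurable h ∧ ∃ K, ∀ x, |h x| ≤ K

variable {E : Type*} [MeasurableSpace E] {h : E → ℝ}

lemma BoundedMeasurable.integrable (hh : BoundedMeasurable h) (μ : Measure E) [IsFiniteMeasure μ] :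
    Integrable h μ := by
  obtain ⟨hm, K, hK⟩ := hh
  exact Integrable.of_bound hm.aestronglyMeasurable K (ae_of_all _ hK)

lemma BoundedMeasurable.mul {h' : E → ℝ} (hh : BoundedMeasurable h) (hh' : BoundedMeasurable h') :
    BoundedMeasurable fun x => h x * h' x := by
  obtain ⟨hm, K, hK⟩ := hh
  obtain ⟨hm', K', hK'⟩ := hh'
  refine ⟨hm.mul hm', K * K', fun x => ?_⟩
  rw [abs_mul]
  exact mul_le_mul (hK x) (hK' x) (abs_nonneg _) ((abs_nonneg _).trans (hK x))

lemma BoundedMeasurable.comp {E' : Type*} [MeasurableSpace E'] {u : E' → E}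
    (hh : BoundedMeasurable h) (hu : Measurable u) : BoundedMeasurable fun x => h (u x) :=
  ⟨hh.1.comp hu, hh.2.imp fun _ hK x => hK (u x)⟩

lemma BoundedMeasurable.kernel {E' : Type*} [MeasurableSpace E'] (hh : BoundedMeasurable h)
    (κ : Kernel E' E) [IsMarkovKernel κ] : BoundedMeasurable fun x => ∫ y, h y ∂κ x := by
  obtain ⟨hm, K, hK⟩ := hh
  refine ⟨hm.stronglyMeasurable.integral_kernel.measurable, K, fun x => ?_⟩
  simpa using norm_integral_le_of_norm_le_const (μ := κ x) (f := h) (ae_of_all _ hK)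

end BoundedMeasurable

section Operators

variable {X : Type*} [MeasurableSpace X] {γ : X → ℝ} {f : Kernel X X} [IsMarkovKernel f]
  {ψ : X × X → ℝ}

lemma BoundedMeasurable.tensorQ (hγ : BoundedMeasurable γ) (hψ : BoundedMeasurable ψ) :
    BoundedMeasurable (tensorQ γ f ψ) := by
  refine ((hγ.comp measurable_fst).mul (hγ.comp measurable_snd)).mul ?_
  simpa only [Kernel.parallelComp_apply] using hψ.kernel (f ∥ₖ f)

lemma BoundedMeasurable.collision (hψ : BoundedMeasurable ψ) (ε : Bool) :
    BoundedMeasurable (collision ε ψ) := by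
  cases ε
  · have : AlphaSMC.collision false ψ = ψ := by
      ext p
      simp [AlphaSMC.collision]
    rwa [this]
  · have : AlphaSMC.collision true ψ = fun p => ψ (p.1, p.1) := by
      ext p
      simp [AlphaSMC.collision]
    rw [this]
    exact hψ.comp (u := fun p : X × X => (p.1, p.1)) (by fun_prop)

lemma integral_mulQ {μ : Measure X} [IsFiniteMeasure μ] (hγ : BoundedMeasurable γ)
    (hpos : ∀ x, 0 ≤ γ x) {h : X → ℝ} (hh : BoundedMeasurable h) :
    ∫ x, h x ∂mulQ γ f μ = ∫ x, γ x * ∫ x', h x' ∂f x ∂μ := by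
  have : IsFiniteMeasure (μ.withDensity fun x => ENNReal.ofReal (γ x)) :=
    isFiniteMeasure_withDensity_ofReal (hγ.integrable μ).2
  have h1 : Integrable (fun p : X × X => h p.2)
      ((μ.withDensity fun x => ENNReal.ofReal (γ x)) ⊗ₘ f) :=
    (hh.comp measurable_snd).integrable _
  rw [mulQ, ← Measure.snd_compProd, Measure.snd,
    integral_map measurable_snd.aemeasurable hh.1.aestronglyMeasurable,
    Measure.integral_compProd h1, integral_withDensity_eq_integral_toReal_smul
      hγ.1.ennreal_ofReal (ae_of_all _ fun x => ENNReal.ofReal_lt_top)]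
  congr 1
  ext x
  rw [ENNReal.toReal_ofReal (hpos x), smul_eq_mul]

end Operators

section Moments

variable {X : Type*} [MeasurableSpace X] {ι : Type*} [Fintype ι] [DecidableEq ι]
  {π₀ : Measure X} {α : Matrix ι ι ℝ} {γ : X → ℝ} {f : Kernel X X}
  [IsProbabilityMeasure π₀] [IsMarkovKernel f]

lemma nextWeight_mul_integral_nextLaw {y : ι → ℝ × X} {i : ι}
    (hnn : ∀ j, 0 ≤ α i j * (y j).1 * γ (y j).2) (hpos : 0 < nextWeight α γ y i) {h : X → ℝ}
    (hh : BoundedMeasurable h) :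
    nextWeight α γ y i * ∫ x, h x ∂nextLaw π₀ α γ f y i
      = ∑ j, α i j * (y j).1 * γ (y j).2 * ∫ x, h x ∂f (y j).2 := by
  rw [nextLaw_eq hnn hpos, integral_smul_measure, integral_finsetSum_measure fun j _ =>
    (hh.integrable _).smul_measure ENNReal.ofReal_ne_top, ENNReal.toReal_inv,
    ENNReal.toReal_ofReal hpos.le, smul_eq_mul, mul_inv_cancel_left₀ hpos.ne']
  refine Finset.sum_congr rfl fun j _ => ?_
  rw [integral_smul_measure, ENNReal.toReal_ofReal (hnn j), smul_eq_mul]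

lemma nextWeight_mul_nextWeight_mul_integral {y : ι → ℝ × X} {i i' : ι}
    (hnn : ∀ i j, 0 ≤ α i j * (y j).1 * γ (y j).2) (hpos : ∀ i, 0 < nextWeight α γ y i)
    {ψ : X × X → ℝ} (hψ : BoundedMeasurable ψ) :
    nextWeight α γ y i * nextWeight α γ y i' *
        ∫ p, ψ p ∂(nextLaw π₀ α γ f y i).prod (nextLaw π₀ α γ f y i')
      = ∑ j, ∑ j', α i j * α i' j' *
          ((y j).1 * (y j').1 * tensorQ γ f ψ ((y j).2, (y j').2)) := by
  have h1 (x : X) : BoundedMeasurable fun x' => ψ (x, x') := hψ.comp measurable_prodMk_left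
  have h2 (ν : Measure X) [IsProbabilityMeasure ν] :
      BoundedMeasurable fun x => ∫ x', ψ (x, x') ∂ν := by
    refine ⟨hψ.1.stronglyMeasurable.integral_prod_right'.measurable, hψ.2.imp fun K hK x => ?_⟩
    simpa using norm_integral_le_of_norm_le_const (μ := ν) (f := fun x' => ψ (x, x'))
      (ae_of_all _ fun x' => hK (x, x'))
  rw [integral_prod _ (hψ.integrable _), mul_comm (nextWeight α γ y i), mul_assoc,
    nextWeight_mul_integral_nextLaw (hnn i) (hpos i) (h2 _), Finset.mul_sum]
  refine Finset.sum_congr rfl fun j _ => ?_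
  have h3 : nextWeight α γ y i' * ∫ x, ∫ x', ψ (x, x') ∂nextLaw π₀ α γ f y i' ∂f (y j).2
      = ∑ j', α i' j' * (y j').1 * γ (y j').2 * ∫ p, ψ p ∂(f (y j).2).prod (f (y j').2) := by
    have e (j') : α i' j' * (y j').1 * γ (y j').2 * ∫ p, ψ p ∂(f (y j).2).prod (f (y j').2)
        = ∫ x, α i' j' * (y j').1 * γ (y j').2 * ∫ x', ψ (x, x') ∂f (y j').2 ∂f (y j).2 := by
      rw [integral_prod _ (hψ.integrable _), integral_const_mul]
    rw [Finset.sum_congr rfl fun j' _ => e j', ← integral_const_mul,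
      ← integral_finsetSum _ fun j' _ => ((h2 _).integrable _).const_mul _]
    congr 1
    ext x
    exact nextWeight_mul_integral_nextLaw (hnn i') (hpos i') (h1 x)
  rw [mul_left_comm, h3, Finset.mul_sum]
  refine Finset.sum_congr rfl fun j' _ => ?_
  simp only [tensorQ]
  ring

/-- The joint law of two coordinates of a product measure. -/
lemma integral_pi_pair (μ : ι → Measure X) [∀ i, IsProbabilityMeasure (μ i)] {ψ : X × X → ℝ}
    (hψ : BoundedMeasurable ψ) (i j : ι) :
    ∫ x, ψ (x i, x j) ∂Measure.pi μ = ∫ p, collision (decide (i = j)) ψ p ∂(μ i).prod (μ j) := by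
  by_cases hij : i = j
  · subst hij
    have h : BoundedMeasurable fun x => ψ (x, x) := hψ.comp (by fun_prop)
    simp only [decide_true, collision, if_true]
    rw [integral_comp_eval (μ := μ) (i := i) h.1.aestronglyMeasurable,
      integral_prod _ ((h.comp measurable_fst).integrable _)]
    simp
  · have hi : iIndepFun (fun i (x : ι → X) => x i) (Measure.pi μ) :=
      iIndepFun_pi (X := fun _ x => x) fun i => aemeasurable_id
    have h := (indepFun_iff_map_prod_eq_prod_map_map (measurable_pi_apply i).aemeasurable
      (measurable_pi_apply j).aemeasurable).1 (hi.indepFun hij)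
    have e (k) : (Measure.pi μ).map (fun x => x k) = μ k := (measurePreserving_eval μ k).map_eq
    rw [e, e] at h
    simp only [hij, decide_false, collision, Bool.false_eq_true, if_false]
    rw [← h, integral_map (by fun_prop) hψ.1.aestronglyMeasurable]

variable {g : ℕ → X → ℝ} {Ω : Type*} [MeasurableSpace Ω] {P : Measure Ω} [IsProbabilityMeasure P]
  {ζ : ℕ → ι → Ω → X}

lemma IsParticleSystem.integral_state_succ
    (hS : IsParticleSystem π₀ (sampling α f g) P ζ)
    (hg : ∀ n, Measurable (g n)) (hg_pos : ∀ n x, 0 < g n x) (hα0 : ∀ i j, 0 ≤ α i j)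
    (hα1 : ∀ i, ∑ j, α i j = 1) (n : ℕ) {F : (ι → ℝ × X) → ℝ} (hF : Measurable F)
    (hb : ∃ K, ∀ ω, |F (state α g ζ (n + 1) ω)| ≤ K) :
    ∫ ω, F (state α g ζ (n + 1) ω) ∂P
      = ∫ ω, ∫ x, F (fun i => (nextWeight α (g n) (state α g ζ n ω) i, x i))
          ∂Measure.pi (fun i => nextLaw π₀ α (g n) f (state α g ζ n ω) i) ∂P := by
  have hY : Measurable (state α g ζ n) := hS.measurable_state hg n
  have hZ : Measurable fun ω i => ζ (n + 1) i ω :=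
    measurable_pi_lambda _ fun i => hS.measurable (n + 1) i
  have hF' : Measurable fun p : (ι → ℝ × X) × (ι → X) =>
      F fun i => (nextWeight α (g n) p.1 i, p.2 i) := by
    refine hF.comp (measurable_pi_lambda _ fun i => ?_)
    exact ((measurable_nextWeight (hg n) i).comp measurable_fst).prodMk (by fun_prop)
  obtain ⟨K, hK⟩ := hb
  have hint : Integrable (fun p : (ι → ℝ × X) × (ι → X) =>
      F fun i => (nextWeight α (g n) p.1 i, p.2 i))
      (P.map fun ω => (state α g ζ n ω, fun i => ζ (n + 1) i ω)) := by
    rw [integrable_map_measure hF'.aestronglyMeasurable (hY.prodMk hZ).aemeasurable]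
    exact Integrable.of_bound (hF'.comp (hY.prodMk hZ)).aestronglyMeasurable K (ae_of_all _ hK)
  have h1 := integral_map (hY.prodMk hZ).aemeasurable hF'.aestronglyMeasurable (μ := P)
  rw [hS.map_state_prodMk hg hg_pos hα0 hα1] at h1 hint
  rw [Measure.integral_compProd hint] at h1
  refine h1.symm.trans (integral_map hY.aemeasurable ?_)
  exact (hF'.stronglyMeasurable.integral_kernel_prod_right'
    (κ := stepKernel π₀ α (g n) f (hg n))).aestronglyMeasurable

section Bound

variable (hg_pos : ∀ n x, 0 < g n x) (hα0 : ∀ i j, 0 ≤ α i j) (hα1 : ∀ i, ∑ j, α i j = 1)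
include hg_pos hα0 hα1

lemma abs_state_fst_le {C : ℕ → ℝ} (hC : ∀ n x, g n x ≤ C n) (n : ℕ) (ω : Ω) (i : ι) :
    |(state α g ζ n ω i).1| ≤ ∏ k ∈ Finset.range n, C k := by
  have h := weight_pos hg_pos hα0 hα1 (fun k j => ζ k j ω) n i
  exact (abs_of_pos h).le.trans (weight_le hg_pos hα0 hα1 hC (fun k j => ζ k j ω) n i)

lemma exists_abs_state_fst_le (hg : ∀ n, BoundedMeasurable (g n)) (n : ℕ) :
    ∃ K, ∀ (ω : Ω) (i : ι), |(state α g ζ n ω i).1| ≤ K := by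
  choose C hC using fun n => (hg n).2
  exact ⟨∏ k ∈ Finset.range n, C k, fun ω i =>
    abs_state_fst_le hg_pos hα0 hα1 (fun n x => (le_abs_self _).trans (hC n x)) n ω i⟩

lemma exists_abs_state_mul_le (hg : ∀ n, BoundedMeasurable (g n)) (n : ℕ) {ψ : X × X → ℝ}
    (hψ : BoundedMeasurable ψ) (i i' : ι) :
    ∃ K, ∀ ω : Ω, |(state α g ζ n ω i).1 * (state α g ζ n ω i').1 *
      ψ ((state α g ζ n ω i).2, (state α g ζ n ω i').2)| ≤ K := by
  obtain ⟨K, hK⟩ := exists_abs_state_fst_le (ζ := ζ) hg_pos hα0 hα1 hg n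
  obtain ⟨L, hL⟩ := hψ.2
  refine ⟨K * K * L, fun ω => ?_⟩
  have hK0 : 0 ≤ K := (abs_nonneg _).trans (hK ω i)
  rw [abs_mul, abs_mul]
  gcongr
  exacts [hK ω i, hK ω i', hL _]

lemma nextLaw_state_hyps (n : ℕ) (ω : Ω) :
    (∀ i j, 0 ≤ α i j * (state α g ζ n ω j).1 * g n (state α g ζ n ω j).2) ∧
      ∀ i, 0 < nextWeight α (g n) (state α g ζ n ω) i := by
  have hpos := weight_pos hg_pos hα0 hα1 (fun k j => ζ k j ω)
  exact ⟨fun i j => mul_nonneg (mul_nonneg (hα0 i j) (hpos n j).le) (hg_pos n _).le,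
    fun i => hpos (n + 1) i⟩

end Bound

lemma IsParticleSystem.integrable_state_mul {κ : ℕ → ι → (ℕ → ι → X) → Set X → ℝ}
    (hS : IsParticleSystem π₀ κ P ζ)
    (hg : ∀ n, BoundedMeasurable (g n)) (hg_pos : ∀ n x, 0 < g n x) (hα0 : ∀ i j, 0 ≤ α i j)
    (hα1 : ∀ i, ∑ j, α i j = 1) (n : ℕ) {ψ : X × X → ℝ} (hψ : BoundedMeasurable ψ) (i i' : ι) :
    Integrable (fun ω => (state α g ζ n ω i).1 * (state α g ζ n ω i').1 *
        ψ ((state α g ζ n ω i).2, (state α g ζ n ω i').2)) P := by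
  have hY : Measurable (state α g ζ n) := hS.measurable_state (fun n => (hg n).1) n
  obtain ⟨K, hK⟩ := exists_abs_state_mul_le (ζ := ζ) hg_pos hα0 hα1 hg n hψ i i'
  have hψm := hψ.1
  have hm : Measurable fun y : ι → ℝ × X => (y i).1 * (y i').1 * ψ ((y i).2, (y i').2) := by
    fun_prop
  exact Integrable.of_bound (hm.comp hY).aestronglyMeasurable K (ae_of_all _ hK)

/-- The recursion for the second moments. Two distinct particles move independently, and
`E[(W^i)² h(ζ^i) | past] = W^i ∑_j α^{ij} W^j Q(h)(ζ^j)`; both cases are a double sum over the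
ancestors, with the function `ψ` restricted to the diagonal in the second one. -/
lemma IsParticleSystem.integral_mul_succ
    (hS : IsParticleSystem π₀ (sampling α f g) P ζ)
    (hg : ∀ n, BoundedMeasurable (g n)) (hg_pos : ∀ n x, 0 < g n x) (hα0 : ∀ i j, 0 ≤ α i j)
    (hα1 : ∀ i, ∑ j, α i j = 1) (n : ℕ) {ψ : X × X → ℝ} (hψ : BoundedMeasurable ψ) (i i' : ι) :
    ∫ ω, (state α g ζ (n + 1) ω i).1 * (state α g ζ (n + 1) ω i').1 *
        ψ ((state α g ζ (n + 1) ω i).2, (state α g ζ (n + 1) ω i').2) ∂P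
      = ∑ j, ∑ j', α i j * α i' j' * ∫ ω, (state α g ζ n ω j).1 * (state α g ζ n ω j').1 *
          tensorQ (g n) f (collision (decide (i = i')) ψ)
            ((state α g ζ n ω j).2, (state α g ζ n ω j').2) ∂P := by
  have hψm := hψ.1
  have hcol := hψ.collision (decide (i = i'))
  rw [hS.integral_state_succ (fun n => (hg n).1) hg_pos hα0 hα1 n
    (F := fun y => (y i).1 * (y i').1 * ψ ((y i).2, (y i').2)) (by fun_prop)
    (exists_abs_state_mul_le hg_pos hα0 hα1 hg (n + 1) hψ i i')]
  have h1 (ω) := nextLaw_state_hyps (ζ := ζ) hg_pos hα0 hα1 n ω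
  simp only [integral_const_mul, integral_pi_pair _ hψ]
  rw [integral_congr_ae (ae_of_all _ fun ω =>
    nextWeight_mul_nextWeight_mul_integral (h1 ω).1 (h1 ω).2 hcol)]
  have hint (j j' : ι) := (hS.integrable_state_mul hg hg_pos hα0 hα1 n
    ((hg n).tensorQ (f := f) hcol) j j').const_mul (α i j * α i' j')
  rw [integral_finsetSum _ fun j _ => integrable_finsetSum _ fun j' _ => hint j j']
  refine Finset.sum_congr rfl fun j _ => ?_
  rw [integral_finsetSum _ fun j' _ => hint j j']
  exact Finset.sum_congr rfl fun j' _ => integral_const_mul _ _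

lemma IsParticleSystem.integral_mul_zero {κ : ℕ → ι → (ℕ → ι → X) → Set X → ℝ}
    (hS : IsParticleSystem π₀ κ P ζ) {ψ : X × X → ℝ} (hψ : BoundedMeasurable ψ) (i i' : ι) :
    ∫ ω, (state α g ζ 0 ω i).1 * (state α g ζ 0 ω i').1 *
        ψ ((state α g ζ 0 ω i).2, (state α g ζ 0 ω i').2) ∂P
      = ∫ p, collision (decide (i = i')) ψ p ∂π₀.prod π₀ := by
  have hψm := hψ.1
  rw [← integral_pi_pair (fun _ => π₀) hψ, ← hS.map_zero, integral_map
    (measurable_pi_lambda _ fun i => hS.measurable 0 i).aemeasurable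
    (Measurable.aestronglyMeasurable (by fun_prop))]
  simp [state, weight]

lemma isFiniteMeasure_mulQ {μ : Measure X} [IsFiniteMeasure μ] (hγ : BoundedMeasurable γ) :
    IsFiniteMeasure (mulQ γ f μ) := by
  have : IsFiniteMeasure (μ.withDensity fun x => ENNReal.ofReal (γ x)) :=
    isFiniteMeasure_withDensity_ofReal (hγ.integrable μ).2
  unfold mulQ
  infer_instance

lemma isFiniteMeasure_unnormalised (hg : ∀ n, BoundedMeasurable (g n)) (n : ℕ) :
    IsFiniteMeasure (unnormalised π₀ f g n) := by
  induction n with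
  | zero =>
    unfold unnormalised
    infer_instance
  | succ n ih => exact isFiniteMeasure_mulQ (hg n)

/-- The weighted particles are unbiased for the unnormalised measures. -/
lemma IsParticleSystem.integral_weight_mul
    (hS : IsParticleSystem π₀ (sampling α f g) P ζ)
    (hg : ∀ n, BoundedMeasurable (g n)) (hg_pos : ∀ n x, 0 < g n x) (hα0 : ∀ i j, 0 ≤ α i j)
    (hα1 : ∀ i, ∑ j, α i j = 1) (n : ℕ) {h : X → ℝ} (hh : BoundedMeasurable h) (i : ι) :
    ∫ ω, (state α g ζ n ω i).1 * h (state α g ζ n ω i).2 ∂P = ∫ x, h x ∂unnormalised π₀ f g n := by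
  induction n generalizing h i with
  | zero =>
    rw [unnormalised, ← hS.law_zero i, integral_map (hS.measurable 0 i).aemeasurable
      hh.1.aestronglyMeasurable]
    simp [state, weight]
  | succ n ih =>
    have hhm := hh.1
    have := isFiniteMeasure_unnormalised (π₀ := π₀) (f := f) hg n
    have hbd (n) {h : X → ℝ} (hh : BoundedMeasurable h) (i : ι) :
        ∃ K, ∀ ω : Ω, |(state α g ζ n ω i).1 * h (state α g ζ n ω i).2| ≤ K := by
      obtain ⟨K, hK⟩ := exists_abs_state_fst_le (ζ := ζ) hg_pos hα0 hα1 hg n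
      obtain ⟨L, hL⟩ := hh.2
      refine ⟨K * L, fun ω => ?_⟩
      rw [abs_mul]
      exact mul_le_mul (hK ω i) (hL _) (abs_nonneg _) ((abs_nonneg _).trans (hK ω i))
    have hQ : BoundedMeasurable fun x => g n x * ∫ x', h x' ∂f x := (hg n).mul (hh.kernel f)
    have hQm := hQ.1
    have hY : Measurable (state α g ζ n) := hS.measurable_state (fun n => (hg n).1) n
    rw [hS.integral_state_succ (fun n => (hg n).1) hg_pos hα0 hα1 n
      (F := fun y => (y i).1 * h (y i).2) (by fun_prop) (hbd (n + 1) hh i)]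
    have h1 (ω) := nextLaw_state_hyps (ζ := ζ) hg_pos hα0 hα1 n ω
    have heval (μ : ι → Measure X) [∀ i, IsProbabilityMeasure (μ i)] :
        ∫ x, h (x i) ∂Measure.pi μ = ∫ x, h x ∂μ i :=
      integral_comp_eval hhm.aestronglyMeasurable
    simp only [integral_const_mul, heval]
    rw [integral_congr_ae (ae_of_all _ fun ω =>
      nextWeight_mul_integral_nextLaw ((h1 ω).1 i) ((h1 ω).2 i) hh)]
    have e (ω : Ω) (j : ι) : α i j * (state α g ζ n ω j).1 * g n (state α g ζ n ω j).2 *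
        ∫ x, h x ∂f (state α g ζ n ω j).2
        = α i j * ((state α g ζ n ω j).1 *
          (fun x => g n x * ∫ x', h x' ∂f x) (state α g ζ n ω j).2) := by
      ring
    simp only [e]
    have hint (j : ι) : Integrable (fun ω => α i j * ((state α g ζ n ω j).1 *
        (fun x => g n x * ∫ x', h x' ∂f x) (state α g ζ n ω j).2)) P := by
      obtain ⟨K, hK⟩ := hbd n hQ j
      have hm : Measurable fun y : ι → ℝ × X =>
          (y j).1 * (fun x => g n x * ∫ x', h x' ∂f x) (y j).2 :=
        (measurable_fst.comp (measurable_pi_apply j)).mul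
          (hQm.comp (measurable_snd.comp (measurable_pi_apply j)))
      exact (Integrable.of_bound (hm.comp hY).aestronglyMeasurable K (ae_of_all _ hK)).const_mul _
    rw [integral_finsetSum _ fun j _ => hint j]
    simp only [integral_const_mul, ih hQ]
    rw [← Finset.sum_mul, hα1, one_mul, unnormalised,
      integral_mulQ (hg n) (fun x => (hg_pos n x).le) hh]

end Moments

/-! ### The backward chain on the integers -/

section Backward

variable {αinf : ℤ → ℤ → ℝ} {β : ℕ}

lemma pathWeight_snoc (hα0 : ∀ i j, 0 ≤ αinf i j) (n : ℕ) (u v : ℤ) (p : Fin (n + 1) → ℤ × ℤ)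
    (x : ℤ × ℤ) :
    ENNReal.ofReal (pathWeight αinf (n + 1) u v (Fin.snoc p x : Fin (n + 2) → ℤ × ℤ))
      = if x = (u, v) then
          ENNReal.ofReal (αinf u (p (Fin.last n)).1 * αinf v (p (Fin.last n)).2) *
          ENNReal.ofReal (pathWeight αinf n (p (Fin.last n)).1 (p (Fin.last n)).2 p) else 0 := by
  split_ifs with h
  · rw [← ENNReal.ofReal_mul (mul_nonneg (hα0 _ _) (hα0 _ _)), pathWeight, pathWeight,
      Fin.prod_univ_castSucc]
    subst h
    simp only [Fin.snoc_last, if_true, one_mul, Fin.succ_last, Fin.snoc_castSucc,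
      Fin.succ_castSucc]
    ring_nf
  · simp [pathWeight, h]

/-- The first backward step of the chain. -/
lemma backwardLaw_succ (hα0 : ∀ i j, 0 ≤ αinf i j)
    (hband : ∀ i j, (β : ℤ) < |i - j| → αinf i j = 0) (n : ℕ) (u v : ℤ) :
    backwardLaw αinf (n + 1) u v
      = ∑ x ∈ Finset.Icc (u - β) (u + β) ×ˢ Finset.Icc (v - β) (v + β),
          ENNReal.ofReal (αinf u x.1 * αinf v x.2) •
            (backwardLaw αinf n x.1 x.2).map
              fun p => (Fin.snoc p (u, v) : Fin (n + 2) → ℤ × ℤ) := by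
  ext s hs
  have hm : Measurable fun p : Fin (n + 1) → ℤ × ℤ =>
      (Fin.snoc p (u, v) : Fin (n + 2) → ℤ × ℤ) := measurable_of_countable _
  simp only [Measure.coe_finsetSum, Finset.sum_apply, Measure.smul_apply, smul_eq_mul,
    Measure.map_apply hm hs, backwardLaw, Measure.sum_apply _ hs,
    Measure.sum_apply _ (hm hs), Measure.dirac_apply' _ hs, Measure.dirac_apply' _ (hm hs)]
  rw [← (Fin.snocEquiv fun _ : Fin (n + 2) => ℤ × ℤ).tsum_eq, ENNReal.tsum_prod',
    tsum_eq_single (u, v)]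
  · simp only [← ENNReal.tsum_mul_left]
    rw [← Summable.tsum_finsetSum fun _ _ => ENNReal.summable]
    refine tsum_congr fun p => ?_
    change ENNReal.ofReal (pathWeight αinf (n + 1) u v (Fin.snoc p (u, v) : Fin (n + 2) → ℤ × ℤ)) *
      s.indicator 1 (Fin.snoc p (u, v) : Fin (n + 2) → ℤ × ℤ) = _
    rw [pathWeight_snoc hα0, if_pos rfl]
    rw [Finset.sum_eq_single (p (Fin.last n)), mul_assoc]
    · rfl
    · intro x _ hx
      simp [pathWeight, Ne.symm hx]
    · intro hx
      have : αinf u (p (Fin.last n)).1 * αinf v (p (Fin.last n)).2 = 0 := by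
        rw [Finset.mem_product, not_and_or] at hx
        rcases hx with hx | hx <;> rw [Finset.mem_Icc, not_and_or] at hx
        · rw [hband u _ (lt_abs.2 (by omega)), zero_mul]
        · rw [hband v _ (lt_abs.2 (by omega)), mul_zero]
      rw [this, ENNReal.ofReal_zero, zero_mul]
  · intro x hx
    refine ENNReal.tsum_eq_zero.2 fun p => ?_
    change ENNReal.ofReal (pathWeight αinf (n + 1) u v (Fin.snoc p x : Fin (n + 2) → ℤ × ℤ)) * _ = _
    rw [pathWeight_snoc hα0, if_neg hx, zero_mul]

lemma backwardLaw_zero (u v : ℤ) : backwardLaw αinf 0 u v = Measure.dirac fun _ => (u, v) := by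
  ext s hs
  rw [backwardLaw, Measure.sum_apply _ hs, tsum_eq_single fun _ => (u, v)]
  · simp [pathWeight]
  · intro p hp
    have : p (Fin.last 0) ≠ (u, v) := by
      intro h
      refine hp (funext fun k => ?_)
      rw [Subsingleton.elim (α := Fin 1) k (Fin.last 0), h]
    rw [pathWeight, if_neg this]
    simp

lemma isFiniteMeasure_backwardLaw (hα0 : ∀ i j, 0 ≤ αinf i j)
    (hband : ∀ i j, (β : ℤ) < |i - j| → αinf i j = 0) (n : ℕ) (u v : ℤ) :
    IsFiniteMeasure (backwardLaw αinf n u v) := by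
  induction n generalizing u v with
  | zero =>
    rw [backwardLaw_zero]
    infer_instance
  | succ n ih =>
    rw [backwardLaw_succ hα0 hband]
    have (x : ℤ × ℤ) : IsFiniteMeasure (ENNReal.ofReal (αinf u x.1 * αinf v x.2) •
        (backwardLaw αinf n x.1 x.2).map
          fun p => (Fin.snoc p (u, v) : Fin (n + 2) → ℤ × ℤ)) :=
      Measure.smul_finite _ ENNReal.ofReal_ne_top
    infer_instance

variable {X : Type*} [MeasurableSpace X]

/-- The expectation `E_{u,v}[π₀^{⊗2} C_{ε_0} Q_1^{⊗2} ⋯ Q_n^{⊗2} C_{ε_n}(ψ)]` over the backward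
chain. -/
def pathMoment (αinf : ℤ → ℤ → ℝ) (π₀ : Measure X) (f : Kernel X X) (g : ℕ → X → ℝ) (n : ℕ)
    (u v : ℤ) (ψ : X × X → ℝ) : ℝ :=
  ∫ p, (∫ q, tensorChain f g n (fun k => decide ((p k).1 = (p k).2)) ψ q ∂(π₀.prod π₀))
    ∂(backwardLaw αinf n u v)

variable {π₀ : Measure X} {f : Kernel X X} {g : ℕ → X → ℝ}

lemma pathMoment_zero (u v : ℤ) (ψ : X × X → ℝ) :
    pathMoment αinf π₀ f g 0 u v ψ
      = ∫ q, collision (decide (u = v)) ψ q ∂(π₀.prod π₀) := by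
  rw [pathMoment, backwardLaw_zero, integral_dirac]
  rfl

lemma pathMoment_succ (hα0 : ∀ i j, 0 ≤ αinf i j)
    (hband : ∀ i j, (β : ℤ) < |i - j| → αinf i j = 0) (n : ℕ) (u v : ℤ) (ψ : X × X → ℝ) :
    pathMoment αinf π₀ f g (n + 1) u v ψ
      = ∑ u' ∈ Finset.Icc (u - β) (u + β), ∑ v' ∈ Finset.Icc (v - β) (v + β),
          αinf u u' * αinf v v' * pathMoment αinf π₀ f g n u' v'
            (tensorQ (g n) f (collision (decide (u = v)) ψ)) := by
  have hfin := isFiniteMeasure_backwardLaw hα0 hband n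
  have hm : Measurable fun p : Fin (n + 1) → ℤ × ℤ =>
      (Fin.snoc p (u, v) : Fin (n + 2) → ℤ × ℤ) := measurable_of_countable _
  -- the integrand only depends on which of the pairs collide, hence takes finitely many values
  have hbd : ∃ K, ∀ p : Fin (n + 2) → ℤ × ℤ, ‖∫ q, tensorChain f g (n + 1)
      (fun k => decide ((p k).1 = (p k).2)) ψ q ∂(π₀.prod π₀)‖ ≤ K := by
    obtain ⟨K, hK⟩ := (Set.finite_range fun ε : Fin (n + 2) → Bool =>
      ‖∫ q, tensorChain f g (n + 1) ε ψ q ∂(π₀.prod π₀)‖).bddAbove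
    exact ⟨K, fun p => hK ⟨_, rfl⟩⟩
  obtain ⟨K, hK⟩ := hbd
  rw [pathMoment, backwardLaw_succ hα0 hband, integral_finsetSum_measure, Finset.sum_product]
  · refine Finset.sum_congr rfl fun u' _ => Finset.sum_congr rfl fun v' _ => ?_
    rw [integral_smul_measure, ENNReal.toReal_ofReal (mul_nonneg (hα0 _ _) (hα0 _ _)),
      smul_eq_mul, integral_map hm.aemeasurable (measurable_of_countable _).aestronglyMeasurable]
    congr 1
    simp only [pathMoment, tensorChain, Fin.snoc_castSucc, Fin.snoc_last]
  · intro x _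
    have : IsFiniteMeasure ((backwardLaw αinf n x.1 x.2).map
      fun p => (Fin.snoc p (u, v) : Fin (n + 2) → ℤ × ℤ)) := inferInstance
    refine Integrable.smul_measure ?_ ENNReal.ofReal_ne_top
    exact Integrable.of_bound (measurable_of_countable _).aestronglyMeasurable K (ae_of_all _ hK)

lemma pathMoment_shift (hα0 : ∀ i j, 0 ≤ αinf i j)
    (hband : ∀ i j, (β : ℤ) < |i - j| → αinf i j = 0) {M : ℤ}
    (hper : ∀ i j, αinf (i + M) (j + M) = αinf i j) (n : ℕ) (u v : ℤ) (ψ : X × X → ℝ) :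
    pathMoment αinf π₀ f g n (u + M) (v + M) ψ = pathMoment αinf π₀ f g n u v ψ := by
  induction n generalizing u v ψ with
  | zero => simp only [pathMoment_zero, add_left_inj]
  | succ n ih =>
    have key (a : ℤ) (F : ℤ → ℝ) : ∑ a' ∈ Finset.Icc (a + M - β) (a + M + β), F a'
        = ∑ a' ∈ Finset.Icc (a - β) (a + β), F (a' + M) := by
      rw [show a + M - β = a - β + M by ring, show a + M + β = a + β + M by ring,
        ← Finset.map_add_right_Icc, Finset.sum_map]
      rfl
    simp only [pathMoment_succ hα0 hband, key, hper, ih, add_left_inj]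

end Backward

/-! ### Banded matrices on the cycle -/

section Cycle

variable {N : ℕ} [NeZero N]

lemma intCast_eq_of_abs_lt {a b : ℤ} (h : (a : ZMod N) = b) (hab : |a - b| < N) : a = b := by
  have h1 : (N : ℤ) ∣ a - b := by
    rw [← ZMod.intCast_zmod_eq_zero_iff_dvd]
    simp [h]
  have := Int.eq_zero_of_abs_lt_dvd h1 hab
  omega

/-- The points of `ZMod N` at distance at most `r` from `i`. -/
def near (r : ℕ) (i : ZMod N) : Finset (ZMod N) :=
  (Finset.Icc (-(r : ℤ)) r).image fun d : ℤ => i + d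

lemma mem_near {r : ℕ} {i j : ZMod N} : j ∈ near r i ↔ ∃ d : ℤ, |d| ≤ r ∧ i + d = j := by
  simp [near, abs_le]

lemma card_near_le (r : ℕ) (i : ZMod N) : (near r i).card ≤ 2 * r + 1 := by
  refine Finset.card_image_le.trans ?_
  rw [Int.card_Icc]
  omega

lemma mem_near_comm {r : ℕ} {i j : ZMod N} (h : j ∈ near r i) : i ∈ near r j := by
  obtain ⟨d, hd, rfl⟩ := mem_near.1 h
  exact mem_near.2 ⟨-d, by rwa [abs_neg], by push_cast; ring⟩

lemma mem_near_trans {r s : ℕ} {i j k : ZMod N} (h : j ∈ near r i) (h' : k ∈ near s j) :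
    k ∈ near (r + s) i := by
  obtain ⟨d, hd, rfl⟩ := mem_near.1 h
  obtain ⟨e, he, rfl⟩ := mem_near.1 h'
  refine mem_near.2 ⟨d + e, ?_, by push_cast; ring⟩
  push_cast
  exact (abs_add_le d e).trans (add_le_add hd he)

lemma near_mono {r s : ℕ} (h : r ≤ s) (i : ZMod N) : near r i ⊆ near s i := by
  intro j hj
  obtain ⟨d, hd, rfl⟩ := mem_near.1 hj
  exact mem_near.2 ⟨d, hd.trans (by exact_mod_cast h), rfl⟩

/-- `α` is a row-stochastic matrix on `ZMod N` which vanishes off the band of half-width `β`, and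
coincides in this band with the doubly infinite matrix `αinf`. By `width`, the band does not overlap
itself, so that each of its entries is represented by a unique diagonal offset. -/
structure IsBandedMatrix (β : ℕ) (α : Matrix (ZMod N) (ZMod N) ℝ) (αinf : ℤ → ℤ → ℝ) : Prop where
  nonneg : ∀ i j, 0 ≤ α i j
  row_sum : ∀ i, ∑ j, α i j = 1
  width : 2 * β + 1 ≤ N
  support : ∀ i j, α i j ≠ 0 → j ∈ near β i
  limit : ∀ i j : ℤ, |i - j| ≤ β → αinf i j = α i j
  limit_zero : ∀ i j : ℤ, (β : ℤ) < |i - j| → αinf i j = 0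

variable {β : ℕ} {α : Matrix (ZMod N) (ZMod N) ℝ} {αinf : ℤ → ℤ → ℝ}

lemma IsBandedMatrix.limit_nonneg (hα : IsBandedMatrix β α αinf) (i j : ℤ) : 0 ≤ αinf i j := by
  rcases le_or_gt |i - j| β with h | h
  · rw [hα.limit i j h]
    exact hα.nonneg _ _
  · rw [hα.limit_zero i j h]

/-- Sums over `near r u` are sums over an interval of integers. -/
lemma sum_near {r : ℕ} (hr : 2 * r < N) (u : ℤ) (F : ZMod N → ℝ) :
    ∑ j ∈ near r (u : ZMod N), F j = ∑ d ∈ Finset.Icc (-(r : ℤ)) r, F ((u + d : ℤ) : ZMod N) := by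
  rw [near, Finset.sum_image]
  · refine Finset.sum_congr rfl fun d _ => ?_
    push_cast
    rfl
  · intro d hd e he hde
    simp only [Finset.coe_Icc, Set.mem_Icc] at hd he
    refine intCast_eq_of_abs_lt (N := N) (add_left_cancel hde) ?_
    rw [abs_lt]
    constructor <;> omega

lemma IsBandedMatrix.sum_row (hα : IsBandedMatrix β α αinf) (u : ℤ) (F : ZMod N → ℝ) :
    ∑ j, α u j * F j = ∑ u' ∈ Finset.Icc (u - β) (u + β), αinf u u' * F u' := by
  have h1 : ∑ j ∈ near β (u : ZMod N), α u j * F j = ∑ j, α u j * F j := by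
    refine Finset.sum_subset (Finset.subset_univ _) fun j _ hj => ?_
    have : α u j = 0 := by
      by_contra h
      exact hj (hα.support _ _ h)
    rw [this, zero_mul]
  have hw := hα.width
  rw [← h1, sum_near (by omega), show u - (β : ℤ) = -β + u by ring,
    show u + (β : ℤ) = β + u by ring, ← Finset.map_add_right_Icc, Finset.sum_map]
  refine Finset.sum_congr rfl fun d hd => ?_
  rw [Finset.mem_Icc] at hd
  simp only [addRightEmbedding_apply]
  rw [hα.limit u (d + u) (by rw [abs_le]; constructor <;> omega), add_comm d u]

lemma IsBandedMatrix.influence_subset (hα : IsBandedMatrix β α αinf) (k : ℕ)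
    (A : Finset (ZMod N)) {j : ZMod N} (hj : j ∈ influence α k A) :
    ∃ i ∈ A, j ∈ near (k * β) i := by
  induction k generalizing A with
  | zero => exact ⟨j, hj, mem_near.2 ⟨0, by simp, by simp⟩⟩
  | succ k ih =>
    obtain ⟨i, hi, hij⟩ := ih _ hj
    simp only [Finset.mem_filter, Finset.mem_univ, true_and] at hi
    obtain ⟨i', hi', h⟩ := hi
    refine ⟨i', hi', ?_⟩
    rw [show (k + 1) * β = β + k * β by ring]
    exact mem_near_trans (hα.support _ _ h) hij

lemma IsBandedMatrix.disjoint_influence (hα : IsBandedMatrix β α αinf) {n k : ℕ} (hk : k ≤ n)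
    {A B : Finset (ZMod N)} (hAB : ∀ i ∈ A, Disjoint (near (2 * n * β) i) B) :
    Disjoint (influence α k A) (influence α k B) := by
  rw [Finset.disjoint_left]
  intro j hjA hjB
  obtain ⟨i, hi, hij⟩ := hα.influence_subset k A hjA
  obtain ⟨i', hi', hij'⟩ := hα.influence_subset k B hjB
  refine Finset.disjoint_left.1 (hAB i hi) (near_mono ?_ i (mem_near_trans hij (mem_near_comm hij')))
    hi'
  have := Nat.mul_le_mul_right β hk
  nlinarith

lemma sum_zmod_eq_sum_Ico (F : ZMod N → ℝ) : ∑ i, F i = ∑ u ∈ Finset.Ico (0 : ℤ) N, F u := by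
  symm
  refine Finset.sum_bij (fun u _ => (u : ZMod N)) (fun _ _ => Finset.mem_univ _) ?_ ?_
    fun _ _ => rfl
  · intro a ha b hb h
    rw [Finset.mem_Ico] at ha hb
    refine intCast_eq_of_abs_lt h ?_
    rw [abs_lt]
    constructor <;> omega
  · intro i _
    refine ⟨(i.val : ℤ), ?_, by simp⟩
    rw [Finset.mem_Ico]
    have := ZMod.val_lt i
    omega

lemma sum_Ico_mul_of_periodic {M : ℕ} {G : ℤ → ℝ} (hG : ∀ u, G (u + M) = G u) (m : ℕ) :
    ∑ u ∈ Finset.Ico (0 : ℤ) (M * m : ℕ), G u = m * ∑ u ∈ Finset.Ico (0 : ℤ) M, G u := by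
  have hrange (K : ℕ) : ∑ u ∈ Finset.Ico (0 : ℤ) K, G u = ∑ k ∈ Finset.range K, G k := by
    symm
    refine Finset.sum_nbij (fun k : ℕ => (k : ℤ)) (fun k hk => ?_) (fun a _ b _ h => by simpa using h)
      (fun u hu => ?_) fun _ _ => rfl
    · simpa using hk
    · simp only [Finset.coe_Ico, Set.mem_Ico] at hu
      exact ⟨u.toNat, by simp; omega, by simp; omega⟩
  have hG' (k : ℕ) (u : ℤ) : G (M * k + u) = G u := by
    induction k with
    | zero => simp
    | succ k ih =>
      rw [← ih, ← hG (M * k + u)]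
      congr 1
      push_cast
      ring
  rw [hrange, hrange]
  induction m with
  | zero => simp
  | succ m ih =>
    rw [mul_add_one, Finset.sum_range_add, ih]
    push_cast
    simp only [hG']
    ring

variable {X : Type*} [MeasurableSpace X] {π₀ : Measure X} {f : Kernel X X}
  [IsProbabilityMeasure π₀] [IsMarkovKernel f] {g : ℕ → X → ℝ} {Ω : Type*} [MeasurableSpace Ω]
  {P : Measure Ω} [IsProbabilityMeasure P] {ζ : ℕ → ZMod N → Ω → X}

/-- As long as the backward chain started at `(u, v)` cannot wrap around the cycle, the second
moments of the weighted particles are expectations over this chain. -/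
theorem IsParticleSystem.integral_mul_eq_pathMoment
    (hS : IsParticleSystem π₀ (sampling α f g) P ζ) (hα : IsBandedMatrix β α αinf)
    (hg : ∀ n, BoundedMeasurable (g n)) (hg_pos : ∀ n x, 0 < g n x) (n : ℕ) {ψ : X × X → ℝ}
    (hψ : BoundedMeasurable ψ) {u v : ℤ} (huv : |u - v| + 2 * n * β < N) :
    ∫ ω, (state α g ζ n ω u).1 * (state α g ζ n ω v).1 *
        ψ ((state α g ζ n ω u).2, (state α g ζ n ω v).2) ∂P
      = pathMoment αinf π₀ f g n u v ψ := by
  have hnn : 0 ≤ 2 * (n : ℤ) * β := by positivity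
  have hdec : decide ((u : ZMod N) = v) = decide (u = v) := by
    refine decide_eq_decide.2 ⟨fun h => intCast_eq_of_abs_lt h (by omega), fun h => by rw [h]⟩
  induction n generalizing u v ψ with
  | zero => rw [hS.integral_mul_zero hψ, pathMoment_zero, hdec]
  | succ n ih =>
    rw [hS.integral_mul_succ hg hg_pos hα.nonneg hα.row_sum n hψ, pathMoment_succ
      hα.limit_nonneg hα.limit_zero, hdec]
    conv_lhs =>
      enter [2, j, 2, j']
      rw [mul_assoc]
    simp only [← Finset.mul_sum]
    rw [hα.sum_row u]
    refine Finset.sum_congr rfl fun u' hu' => ?_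
    rw [hα.sum_row v, Finset.mul_sum]
    refine Finset.sum_congr rfl fun v' hv' => ?_
    rw [Finset.mem_Icc] at hu' hv'
    have huv' : |u' - v'| + 2 * n * β < N := by
      have h1 : |u' - v'| ≤ |u - v| + 2 * β := by
        rw [abs_le]
        have := le_abs_self (u - v)
        have := neg_abs_le (u - v)
        constructor <;> omega
      push_cast at huv
      nlinarith
    rw [mul_assoc, ← ih ((hg n).tensorQ (hψ.collision _)) huv' (by positivity)]
    · have : 0 ≤ 2 * (n : ℤ) * β := by positivity
      exact decide_eq_decide.2 ⟨fun h => intCast_eq_of_abs_lt h (by omega), fun h => by rw [h]⟩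

theorem IsParticleSystem.sum_near_integral_mul
    (hS : IsParticleSystem π₀ (sampling α f g) P ζ) (hα : IsBandedMatrix β α αinf)
    (hg : ∀ n, BoundedMeasurable (g n)) (hg_pos : ∀ n x, 0 < g n x) (n : ℕ) {ψ : X × X → ℝ}
    (hψ : BoundedMeasurable ψ) (hN : 4 * n * β < N) :
    ∑ i, ∑ j ∈ near (2 * n * β) i, ∫ ω, (state α g ζ n ω i).1 * (state α g ζ n ω j).1 *
        ψ ((state α g ζ n ω i).2, (state α g ζ n ω j).2) ∂P
      = ∑ u ∈ Finset.Ico (0 : ℤ) N,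
          ∑ v ∈ Finset.Icc (-((2 * n * β : ℕ) : ℤ)) (2 * n * β : ℕ),
            pathMoment αinf π₀ f g n u (u + v) ψ := by
  rw [sum_zmod_eq_sum_Ico]
  refine Finset.sum_congr rfl fun u _ => ?_
  rw [sum_near (by nlinarith)]
  refine Finset.sum_congr rfl fun v hv => ?_
  refine hS.integral_mul_eq_pathMoment hα hg hg_pos n hψ ?_
  rw [Finset.mem_Icc] at hv
  have : |u - (u + v)| ≤ 2 * n * β := by
    rw [abs_le]
    push_cast at hv
    constructor <;> linarith [hv.1, hv.2]
  have : (4 * n * β : ℤ) < N := by exact_mod_cast hN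
  linarith

end Cycle

/-! ### Prediction filters and the asymptotic variance -/

section Filters

variable {X : Type*} [MeasurableSpace X] {π₀ : Measure X} {f : Kernel X X}
  [IsProbabilityMeasure π₀] [IsMarkovKernel f] {g : ℕ → X → ℝ}

lemma mulQ_univ (γ : X → ℝ) (μ : Measure X) :
    mulQ γ f μ Set.univ = ∫⁻ x, ENNReal.ofReal (γ x) ∂μ := by
  rw [mulQ, Measure.bind_apply MeasurableSet.univ (Kernel.aemeasurable _)]
  simp

lemma mulQ_smul (γ : X → ℝ) {c : ENNReal} (μ : Measure X) :
    mulQ γ f (c • μ) = c • mulQ γ f μ := by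
  rw [mulQ, mulQ, withDensity_smul_measure, Measure.bind_smul]

lemma unnormalised_ne_zero (hg : ∀ n, BoundedMeasurable (g n)) (hg_pos : ∀ n x, 0 < g n x)
    (n : ℕ) : unnormalised π₀ f g n Set.univ ≠ 0 := by
  induction n with
  | zero => simp [unnormalised]
  | succ n ih =>
    rw [unnormalised, mulQ_univ, Ne, lintegral_eq_zero_iff (hg n).1.ennreal_ofReal]
    intro h
    refine ih (measure_mono_null (fun x _ => ?_) h)
    simpa using hg_pos n x

lemma predictionFilter_eq (hg : ∀ n, BoundedMeasurable (g n)) (hg_pos : ∀ n x, 0 < g n x)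
    (n : ℕ) : predictionFilter π₀ f g n
      = (unnormalised π₀ f g n Set.univ)⁻¹ • unnormalised π₀ f g n := by
  induction n with
  | zero => simp [predictionFilter, unnormalised]
  | succ n ih =>
    have := isFiniteMeasure_unnormalised (π₀ := π₀) (f := f) hg n
    have h0 := unnormalised_ne_zero (π₀ := π₀) (f := f) hg hg_pos n
    rw [predictionFilter, ih, predictionStep, lintegral_smul_measure, mulQ_smul, smul_smul,
      unnormalised, mulQ_univ, smul_eq_mul, ENNReal.mul_inv, inv_inv,
      mul_right_comm, ENNReal.mul_inv_cancel h0 (measure_ne_top _ _), one_mul]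
    · exact Or.inl (ENNReal.inv_ne_zero.2 (measure_ne_top _ _))
    · exact Or.inl (ENNReal.inv_ne_top.2 h0)

variable {φ : X → ℝ}

lemma integral_predictionFilter (hg : ∀ n, BoundedMeasurable (g n)) (hg_pos : ∀ n x, 0 < g n x)
    (n : ℕ) : ∫ x, φ x ∂predictionFilter π₀ f g n
      = (∫ x, φ x ∂unnormalised π₀ f g n) / (unnormalised π₀ f g n).real Set.univ := by
  rw [predictionFilter_eq hg hg_pos, integral_smul_measure, ENNReal.toReal_inv, smul_eq_mul,
    div_eq_inv_mul]
  rfl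

lemma unnormalised_real_pos (hg : ∀ n, BoundedMeasurable (g n)) (hg_pos : ∀ n x, 0 < g n x)
    (n : ℕ) : 0 < (unnormalised π₀ f g n).real Set.univ := by
  have := isFiniteMeasure_unnormalised (π₀ := π₀) (f := f) hg n
  exact ENNReal.toReal_pos (unnormalised_ne_zero hg hg_pos n) (measure_ne_top _ _)

variable (π₀ f g φ) in
/-- The centred function `φ - π_n(φ)`. -/
def centred (n : ℕ) (x : X) : ℝ := φ x - ∫ y, φ y ∂predictionFilter π₀ f g n

lemma boundedMeasurable_centred (hφ : BoundedMeasurable φ) (n : ℕ) :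
    BoundedMeasurable (centred π₀ f g φ n) := by
  obtain ⟨hm, K, hK⟩ := hφ
  refine ⟨hm.sub measurable_const, K + |∫ y, φ y ∂predictionFilter π₀ f g n|, fun x => ?_⟩
  exact (abs_sub _ _).trans (add_le_add_left (hK x) _)

lemma integral_centred (hg : ∀ n, BoundedMeasurable (g n)) (hg_pos : ∀ n x, 0 < g n x)
    (hφ : BoundedMeasurable φ) (n : ℕ) :
    ∫ x, centred π₀ f g φ n x ∂unnormalised π₀ f g n = 0 := by
  have := isFiniteMeasure_unnormalised (π₀ := π₀) (f := f) hg n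
  have h := unnormalised_real_pos (π₀ := π₀) (f := f) hg hg_pos n
  simp only [centred]
  rw [integral_sub (hφ.integrable _) (integrable_const _), integral_const,
    integral_predictionFilter hg hg_pos, smul_eq_mul, mul_div_cancel₀ _ h.ne', sub_self]

lemma asymptoticVariance_eq {M β : ℕ} (hM : M ≠ 0) (αinf : ℤ → ℤ → ℝ) (hφ : BoundedMeasurable φ)
    (n : ℕ) :
    asymptoticVariance M β αinf π₀ f g φ n
      = 1 / ((unnormalised π₀ f g n).real Set.univ ^ 2 * M) *
        ∑ u ∈ Finset.Ico (0 : ℤ) M,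
          ∑ v ∈ Finset.Icc (-((2 * n * β : ℕ) : ℤ)) (2 * n * β : ℕ),
            pathMoment αinf π₀ f g n u (u + v)
              fun r => centred π₀ f g φ n r.1 * centred π₀ f g φ n r.2 := by
  cases n with
  | zero =>
    have h : BoundedMeasurable (centred π₀ f g φ 0) := boundedMeasurable_centred hφ 0
    have h1 : ∫ q : X × X, centred π₀ f g φ 0 q.1 * centred π₀ f g φ 0 q.1 ∂π₀.prod π₀
        = ∫ x, centred π₀ f g φ 0 x * centred π₀ f g φ 0 x ∂π₀ := by
      rw [integral_prod _ (((h.mul h).comp measurable_fst).integrable _)]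
      simp
    have hM' : (M : ℝ) ≠ 0 := by exact_mod_cast hM
    have h2 : (unnormalised π₀ f g 0).real Set.univ = 1 := by simp [unnormalised]
    simp only [h2, mul_zero, zero_mul, Nat.cast_zero, neg_zero, Finset.Icc_self,
      Finset.sum_singleton, add_zero, pathMoment_zero, decide_true, collision, if_true, h1,
      Finset.sum_const, Int.card_Ico, sub_zero, Int.toNat_natCast, nsmul_eq_mul, one_pow, one_mul]
    rw [one_div, inv_mul_cancel_left₀ hM', asymptoticVariance]
    simp only [← sq]
    rfl
  | succ n =>
    have : ((2 * (n + 1) * β : ℕ) : ℤ) = 2 * (n + 1 : ℤ) * β := by push_cast; ring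
    rw [this]
    rfl

end Filters

/-! ### The ratio of weighted sums -/

/-- The effect on `exp (i t z / D)` of replacing `D` by `γ`. If `D` is far from `γ`, the trivial bound
`2` is at most the first term; otherwise `|z (D - γ)|` is estimated with the weight `s`, to be chosen
so that both squares contribute equally. -/
lemma norm_exp_div_sub_exp_div_le {D γ z s : ℝ} (hD : 0 < D) (hγ : 0 < γ) (hs : 0 < s) (t : ℝ) :
    ‖Complex.exp ((t * (z / D) : ℝ) * Complex.I) - Complex.exp ((t * (z / γ) : ℝ) * Complex.I)‖
      ≤ 8 / γ ^ 2 * (D - γ) ^ 2 + |t| / γ ^ 2 * (s * z ^ 2 + s⁻¹ * (D - γ) ^ 2) := by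
  have hB : 0 ≤ |t| / γ ^ 2 * (s * z ^ 2 + s⁻¹ * (D - γ) ^ 2) := by positivity
  have hA : 0 ≤ 8 / γ ^ 2 * (D - γ) ^ 2 := by positivity
  rcases le_or_gt |D - γ| (γ / 2) with h | h
  · have hD2 : γ / 2 ≤ D := by linarith [(abs_le.1 h).1]
    refine (norm_exp_ofReal_mul_I_sub_le _ _).trans ?_
    have h1 : t * (z / D) - t * (z / γ) = t * (z * (γ - D) / (D * γ)) := by
      field_simp
    have h2 : |z * (γ - D)| ≤ (s * z ^ 2 + s⁻¹ * (D - γ) ^ 2) / 2 := by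
      have h3 : 0 ≤ s⁻¹ * (s * |z| - |D - γ|) ^ 2 := by positivity
      have h4 : s⁻¹ * (s * |z| - |D - γ|) ^ 2
          = s * z ^ 2 + s⁻¹ * (D - γ) ^ 2 - 2 * (|z| * |D - γ|) := by
        rw [sub_sq, mul_pow, sq_abs, sq_abs]
        field_simp
        ring
      rw [abs_mul, abs_sub_comm]
      linarith
    rw [h1, abs_mul, abs_div, abs_of_pos (mul_pos hD hγ)]
    calc |t| * (|z * (γ - D)| / (D * γ))
        ≤ |t| * ((s * z ^ 2 + s⁻¹ * (D - γ) ^ 2) / 2 / (γ / 2 * γ)) := by gcongr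
      _ = |t| / γ ^ 2 * (s * z ^ 2 + s⁻¹ * (D - γ) ^ 2) := by field_simp
      _ ≤ _ := by linarith
  · have h1 : 2 ≤ 8 / γ ^ 2 * (D - γ) ^ 2 := by
      rw [div_mul_eq_mul_div, le_div_iff₀ (by positivity), ← sq_abs (D - γ)]
      nlinarith
    refine (norm_sub_le _ _).trans ?_
    rw [Complex.norm_exp_ofReal_mul_I, Complex.norm_exp_ofReal_mul_I]
    linarith

end AlphaSMC

section Variance

variable {Ω ι : Type*} [MeasurableSpace Ω] {P : Measure Ω} [IsProbabilityMeasure P] [Fintype ι]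
  [DecidableEq ι] {ξ : ι → Ω → ℝ} {a : ℝ} {nb : ι → Finset ι} {D : ℕ}

/-- The variance of a sum with small dependency neighbourhoods is at most of the order of the
number of terms. -/
lemma integral_sum_sq_le (hm : ∀ i, Measurable (ξ i)) (hb : ∀ i ω, |ξ i ω| ≤ a) (ha : 0 ≤ a)
    (hmean : ∀ i, ∫ ω, ξ i ω ∂P = 0) (hD : ∀ i, (nb i).card ≤ D)
    (hind : HasDependencyNeighborhoods ξ P nb) :
    ∫ ω, (∑ i, ξ i ω) ^ 2 ∂P ≤ Fintype.card ι * D * a ^ 2 := by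
  have hbb (i j ω) : |ξ i ω * ξ j ω| ≤ a ^ 2 := by
    rw [abs_mul, sq]
    exact mul_le_mul (hb _ _) (hb _ _) (abs_nonneg _) ha
  have hint (i j) : Integrable (fun ω => ξ i ω * ξ j ω) P :=
    Integrable.of_bound (by fun_prop) (a ^ 2) (ae_of_all _ (hbb i j))
  have hcov (i j) (hj : j ∉ nb i) : ∫ ω, ξ i ω * ξ j ω ∂P = 0 := by
    have h1 := hind {i} {j} (by simpa using hj)
    have h2 : IndepFun (ξ i) (ξ j) P :=
      h1.comp (measurable_pi_apply (⟨i, by simp⟩ : ({i} : Finset ι)))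
        (measurable_pi_apply (⟨j, by simp⟩ : ({j} : Finset ι)))
    rw [h2.integral_fun_mul_eq_mul_integral (hm i).aestronglyMeasurable
      (hm j).aestronglyMeasurable, hmean, zero_mul]
  have hle (i j) : ∫ ω, ξ i ω * ξ j ω ∂P ≤ a ^ 2 := by
    have := norm_integral_le_of_norm_le_const (μ := P) (f := fun ω => ξ i ω * ξ j ω)
      (C := a ^ 2) (ae_of_all _ fun ω => hbb i j ω)
    simpa using (le_abs_self _).trans this
  calc ∫ ω, (∑ i, ξ i ω) ^ 2 ∂P = ∑ i, ∑ j, ∫ ω, ξ i ω * ξ j ω ∂P := by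
        simp only [sq, Finset.sum_mul_sum]
        rw [integral_finsetSum _ fun i _ => integrable_finsetSum _ fun j _ => hint i j]
        exact Finset.sum_congr rfl fun i _ => integral_finsetSum _ fun j _ => hint i j
    _ = ∑ i, ∑ j ∈ nb i, ∫ ω, ξ i ω * ξ j ω ∂P := by
        refine Finset.sum_congr rfl fun i _ => ?_
        exact (Finset.sum_subset (Finset.subset_univ _) fun j _ hj => hcov i j hj).symm
    _ ≤ ∑ i : ι, (D : ℝ) * a ^ 2 := by
        refine Finset.sum_le_sum fun i _ =>
          (Finset.sum_le_card_nsmul _ _ _ fun j _ => hle i j).trans ?_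
        rw [nsmul_eq_mul]
        have : ((nb i).card : ℝ) ≤ D := by exact_mod_cast hD i
        gcongr
    _ = _ := by
        rw [Finset.sum_const, Finset.card_univ, nsmul_eq_mul, mul_assoc]

end Variance

namespace AlphaSMC

/-! ### The central limit theorem for banded particle systems -/

section Limit

variable {X : Type*} [MeasurableSpace X] {π₀ : Measure X} {f : Kernel X X}
  [IsProbabilityMeasure π₀] [IsMarkovKernel f] {g : ℕ → X → ℝ} {Ω : Type*} [MeasurableSpace Ω]
  {P : Measure Ω} [IsProbabilityMeasure P] {N : ℕ} [NeZero N] {ζ : ℕ → ZMod N → Ω → X}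
  {β : ℕ} {α : Matrix (ZMod N) (ZMod N) ℝ} {αinf : ℤ → ℤ → ℝ}

lemma IsParticleSystem.hasDependencyNeighborhoods
    (hS : IsParticleSystem π₀ (sampling α f g) P ζ) (hα : IsBandedMatrix β α αinf)
    (hg : ∀ n, BoundedMeasurable (g n)) (hg_pos : ∀ n x, 0 < g n x) (n : ℕ) {h : ℝ × X → ℝ}
    (hh : Measurable h) :
    HasDependencyNeighborhoods (fun i ω => h (state α g ζ n ω i)) P (near (2 * n * β)) :=
  fun _ _ hAB => hS.indepFun_of_disjoint_influence (fun n => (hg n).1) hg_pos hα.nonneg hα.row_sum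
    n (fun _ hk => hα.disjoint_influence hk hAB) hh

/-- The error term in the approximation of the characteristic function of the normalised estimation
error, for dependency neighbourhoods of size `D`, weights bounded by `K`, a test function bounded
by `L`, normalising constant `γ`, asymptotic variance `v`, and `r = N^{-1/2}`. -/
def charFunError (D K L γ v t r : ℝ) : ℝ :=
  6 * D ^ 2 * (K * L / γ) ^ 3 * |t| ^ 3 * Real.exp (v * t ^ 2 / 2) * r +
    (8 / γ ^ 2 * (D * (K + γ) ^ 2 * r ^ 2)
      + |t| / γ ^ 2 * (r * (D * (K * L) ^ 2) + r⁻¹ * (D * (K + γ) ^ 2 * r ^ 2)))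

lemma tendsto_charFunError (D K L γ v t : ℝ) {r : ℕ → ℝ} (hr : Tendsto r atTop (𝓝 0)) :
    Tendsto (fun m => charFunError D K L γ v t (r m)) atTop (𝓝 0) := by
  have h (x : ℝ) : charFunError D K L γ v t x
      = 6 * D ^ 2 * (K * L / γ) ^ 3 * |t| ^ 3 * Real.exp (v * t ^ 2 / 2) * x +
        (8 / γ ^ 2 * (D * (K + γ) ^ 2 * x ^ 2)
          + |t| / γ ^ 2 * (x * (D * (K * L) ^ 2) + D * (K + γ) ^ 2 * x)) := by
    rcases eq_or_ne x 0 with rfl | hx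
    · simp [charFunError]
    · rw [charFunError]
      congr 4
      field_simp
  simp only [h]
  have hc : Continuous fun x : ℝ => 6 * D ^ 2 * (K * L / γ) ^ 3 * |t| ^ 3 *
      Real.exp (v * t ^ 2 / 2) * x + (8 / γ ^ 2 * (D * (K + γ) ^ 2 * x ^ 2)
        + |t| / γ ^ 2 * (x * (D * (K * L) ^ 2) + D * (K + γ) ^ 2 * x)) := by fun_prop
  simpa [Function.comp_def] using (hc.tendsto 0).comp hr

lemma measurable_weightedMean
    (hS : IsParticleSystem π₀ (sampling α f g) P ζ)
    (hg : ∀ n, BoundedMeasurable (g n)) {φ : X → ℝ} (hφ : Measurable φ) (n : ℕ) :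
    Measurable fun ω => weightedMean (weight α g (fun k j => ζ k j ω) n) (fun i => ζ n i ω) φ := by
  have hY : Measurable (state α g ζ n) := hS.measurable_state (fun n => (hg n).1) n
  have hm : Measurable fun y : ZMod N → ℝ × X => (∑ i, (y i).1 * φ (y i).2) / ∑ i, (y i).1 := by
    fun_prop
  exact hm.comp hY

/-- The normalised estimation error is `N^{-1/2} ∑ W^i φ̄(ζ^i)`, a sum with bounded dependency
neighbourhoods, divided by the mean weight, which concentrates at `γ_n(1)`. -/
theorem IsParticleSystem.norm_charFun_sub_le
    (hS : IsParticleSystem π₀ (sampling α f g) P ζ) (hα : IsBandedMatrix β α αinf)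
    (hg : ∀ n, BoundedMeasurable (g n)) (hg_pos : ∀ n x, 0 < g n x) {φ : X → ℝ}
    (hφ : BoundedMeasurable φ) (n : ℕ) (hN : 4 * n * β < N) {M m : ℕ} (hM : M ≠ 0)
    (hNM : N = M * m) (hper : ∀ i j, αinf (i + M) (j + M) = αinf i j) {C : ℕ → ℝ}
    (hC : ∀ n x, g n x ≤ C n) {L : ℝ} (hL : ∀ x, |centred π₀ f g φ n x| ≤ L)
    (hσ : 0 < asymptoticVariance M β αinf π₀ f g φ n) (t : ℝ) :
    ‖∫ ω, Complex.exp ((t * (√N * (weightedMean (weight α g (fun k j => ζ k j ω) n)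
          (fun i => ζ n i ω) φ - ∫ x, φ x ∂predictionFilter π₀ f g n)) : ℝ) * Complex.I) ∂P
        - Complex.exp (-(asymptoticVariance M β αinf π₀ f g φ n * t ^ 2 / 2 : ℝ))‖
      ≤ charFunError (2 * (2 * n * β) + 1 : ℕ) (∏ k ∈ Finset.range n, C k) L
          ((unnormalised π₀ f g n).real Set.univ) (asymptoticVariance M β αinf π₀ f g φ n) t
          (√N)⁻¹ := by
  have hfin := isFiniteMeasure_unnormalised (π₀ := π₀) (f := f) hg n
  have hγ : 0 < (unnormalised π₀ f g n).real Set.univ := unnormalised_real_pos hg hg_pos n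
  have hcent : BoundedMeasurable (centred π₀ f g φ n) := boundedMeasurable_centred hφ n
  have hcentm := hcent.1
  have hY : Measurable (state α g ζ n) := hS.measurable_state (fun n => (hg n).1) n
  have hK := abs_state_fst_le (ζ := ζ) hg_pos hα.nonneg hα.row_sum hC n
  set γ := (unnormalised π₀ f g n).real Set.univ with hγdef
  set v := asymptoticVariance M β αinf π₀ f g φ n with hvdef
  set K := ∏ k ∈ Finset.range n, C k with hKdef
  set D : ℕ := 2 * (2 * n * β) + 1 with hDdef
  have hN0 : (0 : ℝ) < N := by exact_mod_cast Nat.pos_of_ne_zero (NeZero.ne N)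
  set r := (√(N : ℝ))⁻¹ with hrdef
  have hr : 0 < r := inv_pos.2 (Real.sqrt_pos.2 hN0)
  have hr2 : r ^ 2 = (N : ℝ)⁻¹ := by rw [hrdef, inv_pow, Real.sq_sqrt hN0.le]
  have hNr : (N : ℝ) * r ^ 2 = 1 := by rw [hr2, mul_inv_cancel₀ hN0.ne']
  obtain ⟨ω₀⟩ := nonempty_of_isProbabilityMeasure P
  have hK0 : 0 ≤ K := (abs_nonneg _).trans (hK ω₀ 0)
  have hL0 : 0 ≤ L := (abs_nonneg _).trans (hL (ζ 0 0 ω₀))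
  have hD (i : ZMod N) : (near (2 * n * β) i).card ≤ D := card_near_le _ i
  have hcard : (Fintype.card (ZMod N) : ℝ) = N := by rw [ZMod.card]
  -- the summands of the numerator
  set ξ : ZMod N → Ω → ℝ := fun i ω =>
    (state α g ζ n ω i).1 * centred π₀ f g φ n (state α g ζ n ω i).2 with hξ
  have hξm (i) : Measurable (ξ i) := by
    have : Measurable fun y : ZMod N → ℝ × X => (y i).1 * centred π₀ f g φ n (y i).2 := by fun_prop
    exact this.comp hY
  have hξb (i ω) : |ξ i ω| ≤ K * L := by
    rw [hξ, abs_mul]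
    exact mul_le_mul (hK ω i) (hL _) (abs_nonneg _) hK0
  have hξmean (i) : ∫ ω, ξ i ω ∂P = 0 :=
    (hS.integral_weight_mul hg hg_pos hα.nonneg hα.row_sum n hcent i).trans
      (integral_centred hg hg_pos hφ n)
  have hξind : HasDependencyNeighborhoods ξ P (near (2 * n * β)) :=
    hS.hasDependencyNeighborhoods hα hg hg_pos n
      (h := fun y => y.1 * centred π₀ f g φ n y.2) (by fun_prop)
  -- the summands of the numerator, normalised
  set η : ZMod N → Ω → ℝ := fun i ω => ξ i ω * (r / γ) with hη
  have hηm (i) : Measurable (η i) := (hξm i).mul_const _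
  have hηb (i ω) : |η i ω| ≤ K * L / γ * r := by
    have h := hξb i ω
    rw [hη, abs_mul, abs_of_pos (div_pos hr hγ)]
    calc |ξ i ω| * (r / γ) ≤ K * L * (r / γ) := by gcongr
      _ = _ := by ring
  have hηmean (i) : ∫ ω, η i ω ∂P = 0 := by
    simp only [hη, integral_mul_const, hξmean, zero_mul]
  have hηind : HasDependencyNeighborhoods η P (near (2 * n * β)) :=
    hS.hasDependencyNeighborhoods hα hg hg_pos n
      (h := fun y => y.1 * centred π₀ f g φ n y.2 * (r / γ)) (by fun_prop)
  have hv : v = ∑ i, ∑ j ∈ near (2 * n * β) i, ∫ ω, η i ω * η j ω ∂P := by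
    have h1 (i j) : ∫ ω, η i ω * η j ω ∂P = (r / γ) ^ 2 *
        ∫ ω, (state α g ζ n ω i).1 * (state α g ζ n ω j).1 *
        (fun r : X × X => centred π₀ f g φ n r.1 * centred π₀ f g φ n r.2)
          ((state α g ζ n ω i).2, (state α g ζ n ω j).2) ∂P := by
      rw [← integral_const_mul]
      congr 1
      ext ω
      simp only [hη, hξ]
      ring
    simp only [h1, ← Finset.mul_sum]
    rw [hS.sum_near_integral_mul hα hg hg_pos n
      (ψ := fun r : X × X => centred π₀ f g φ n r.1 * centred π₀ f g φ n r.2)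
      ((hcent.comp measurable_fst).mul (hcent.comp measurable_snd)) hN, hNM,
      sum_Ico_mul_of_periodic (M := M), hvdef, asymptoticVariance_eq hM αinf hφ, ← mul_assoc,
      ← hγdef]
    · congr 1
      have hm0 : (m : ℝ) ≠ 0 := by
        rintro h
        rw [hNM, Nat.cast_mul, h, mul_zero] at hN0
        exact lt_irrefl _ hN0
      have hM0 : (M : ℝ) ≠ 0 := by exact_mod_cast hM
      rw [div_pow, hr2, hNM]
      push_cast
      field_simp
    · intro u
      refine Finset.sum_congr rfl fun d _ => ?_
      rw [add_right_comm, pathMoment_shift hα.limit_nonneg hα.limit_zero hper]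
  have hclt := norm_integral_exp_sum_sub_exp_le hηm hηb (by positivity) hηmean hD hηind hv hσ.le t
  -- the fluctuations of the weights
  set χ : ZMod N → Ω → ℝ := fun i ω => (state α g ζ n ω i).1 - γ with hχ
  have hwm (i) : Measurable fun ω => (state α g ζ n ω i).1 :=
    Measurable.comp (g := fun y : ZMod N → ℝ × X => (y i).1) (by fun_prop) hY
  have hχm (i) : Measurable (χ i) := (hwm i).sub measurable_const
  have hχb (i ω) : |χ i ω| ≤ K + γ :=
    (abs_sub _ _).trans (add_le_add (hK ω i) (abs_of_pos hγ).le)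
  have hχmean (i) : ∫ ω, χ i ω ∂P = 0 := by
    have h1 := hS.integral_weight_mul hg hg_pos hα.nonneg hα.row_sum n (h := fun _ => 1)
      ⟨measurable_const, 1, by simp⟩ i
    simp only [mul_one, integral_const, smul_eq_mul] at h1
    have h2 : Integrable (fun ω => (state α g ζ n ω i).1) P :=
      Integrable.of_bound (hwm i).aestronglyMeasurable K (ae_of_all _ fun ω => hK ω i)
    simp only [hχ]
    rw [integral_sub h2 (integrable_const _), h1, integral_const]
    simp [hγdef]
  have hχind : HasDependencyNeighborhoods χ P (near (2 * n * β)) :=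
    hS.hasDependencyNeighborhoods hα hg hg_pos n (h := fun y => y.1 - γ) (by fun_prop)
  have hvarξ := integral_sum_sq_le hξm hξb (by positivity) hξmean hD hξind
  have hvarχ := integral_sum_sq_le hχm hχb (by positivity) hχmean hD hχind
  rw [hcard] at hvarξ hvarχ hclt
  -- the estimation error is a ratio
  set z : Ω → ℝ := fun ω => r * ∑ i, ξ i ω with hz
  set d : Ω → ℝ := fun ω => γ + r ^ 2 * ∑ i, χ i ω with hd
  have hsumW (ω) : ∑ i, (state α g ζ n ω i).1 = N * d ω := by
    have : ∑ i, χ i ω = ∑ i, (state α g ζ n ω i).1 - N * γ := by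
      simp only [hχ, Finset.sum_sub_distrib, Finset.sum_const, Finset.card_univ, ZMod.card,
        nsmul_eq_mul]
    simp only [hd, this]
    linear_combination (-∑ i, (state α g ζ n ω i).1 + N * γ) * hNr
  have hdpos (ω) : 0 < d ω := by
    have h1 : 0 < ∑ i, (state α g ζ n ω i).1 :=
      Finset.sum_pos (fun i _ => weight_pos hg_pos hα.nonneg hα.row_sum (fun k j => ζ k j ω) n i)
        ⟨0, Finset.mem_univ _⟩
    rw [hsumW] at h1
    exact pos_of_mul_pos_right h1 hN0.le
  have hratio (ω) : √N * (weightedMean (weight α g (fun k j => ζ k j ω) n) (fun i => ζ n i ω) φ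
      - ∫ x, φ x ∂predictionFilter π₀ f g n) = z ω / d ω := by
    have h1 : weightedMean (weight α g (fun k j => ζ k j ω) n) (fun i => ζ n i ω) φ
        = (∑ i, (state α g ζ n ω i).1 * φ (state α g ζ n ω i).2)
          / ∑ i, (state α g ζ n ω i).1 := rfl
    have h2 : ∑ i, ξ i ω = ∑ i, (state α g ζ n ω i).1 * φ (state α g ζ n ω i).2
        - (∑ i, (state α g ζ n ω i).1) * ∫ x, φ x ∂predictionFilter π₀ f g n := by
      simp only [hξ, centred, mul_sub, Finset.sum_sub_distrib, Finset.sum_mul]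
    have hs : √(N : ℝ) = N * r := by
      rw [hrdef, ← div_eq_mul_inv, Real.div_sqrt]
    have hd0 := (hdpos ω).ne'
    have hN0' := hN0.ne'
    rw [h1, hz, hs]
    simp only [h2]
    rw [hsumW]
    field_simp
  simp only [hratio]
  have hzm : Measurable z := by fun_prop
  have hdm : Measurable d := by fun_prop
  have hzγ (ω) : z ω / γ = ∑ i, η i ω := by
    simp only [hz, hη, ← Finset.sum_mul]
    ring
  have hint (F : Ω → ℝ) (hF : Measurable F) :
      Integrable (fun ω => Complex.exp ((t * F ω : ℝ) * Complex.I)) P := by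
    refine Integrable.of_bound (C := 1) (by fun_prop) (ae_of_all _ fun ω => ?_)
    rw [Complex.norm_exp_ofReal_mul_I]
  have hz2 : Integrable (fun ω => z ω ^ 2) P := by
    refine Integrable.of_bound (by fun_prop) ((r * (N * (K * L))) ^ 2) (ae_of_all _ fun ω => ?_)
    rw [Real.norm_eq_abs, abs_pow, hz, abs_mul, abs_of_pos hr]
    have := abs_sum_le_card_mul hξb (by positivity) (Finset.card_univ (α := ZMod N)).le ω
    rw [hcard] at this
    gcongr
  have hd2 : Integrable (fun ω => (d ω - γ) ^ 2) P := by
    refine Integrable.of_bound (by fun_prop) ((r ^ 2 * (N * (K + γ))) ^ 2) (ae_of_all _ fun ω => ?_)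
    rw [Real.norm_eq_abs, abs_pow, hd, add_sub_cancel_left, abs_mul, abs_of_pos (pow_pos hr 2)]
    have := abs_sum_le_card_mul hχb (by positivity) (Finset.card_univ (α := ZMod N)).le ω
    rw [hcard] at this
    gcongr
  have hEz : ∫ ω, z ω ^ 2 ∂P ≤ D * (K * L) ^ 2 := by
    simp only [hz, mul_pow, integral_const_mul]
    calc r ^ 2 * ∫ ω, (∑ i, ξ i ω) ^ 2 ∂P ≤ r ^ 2 * (N * D * (K * L) ^ 2) := by gcongr
      _ = _ := by linear_combination (D * (K * L) ^ 2) * hNr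
  have hEd : ∫ ω, (d ω - γ) ^ 2 ∂P ≤ D * (K + γ) ^ 2 * r ^ 2 := by
    simp only [hd, add_sub_cancel_left, mul_pow, integral_const_mul]
    calc (r ^ 2) ^ 2 * ∫ ω, (∑ i, χ i ω) ^ 2 ∂P ≤ (r ^ 2) ^ 2 * (N * D * (K + γ) ^ 2) := by gcongr
      _ = _ := by linear_combination (D * (K + γ) ^ 2 * r ^ 2) * hNr
  have hI2 : Integrable (fun ω => r * z ω ^ 2 + r⁻¹ * (d ω - γ) ^ 2) P :=
    (hz2.const_mul _).add (hd2.const_mul _)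
  have hcmp : ‖∫ ω, Complex.exp ((t * (z ω / d ω) : ℝ) * Complex.I) ∂P
      - ∫ ω, Complex.exp ((t * (z ω / γ) : ℝ) * Complex.I) ∂P‖
      ≤ 8 / γ ^ 2 * (D * (K + γ) ^ 2 * r ^ 2)
        + |t| / γ ^ 2 * (r * (D * (K * L) ^ 2) + r⁻¹ * (D * (K + γ) ^ 2 * r ^ 2)) := by
    rw [← integral_sub (hint (fun ω => z ω / d ω) (hzm.div hdm))
      (hint (fun ω => z ω / γ) (hzm.div_const γ))]
    refine (norm_integral_le_of_norm_le (g := fun ω => 8 / γ ^ 2 * (d ω - γ) ^ 2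
      + |t| / γ ^ 2 * (r * z ω ^ 2 + r⁻¹ * (d ω - γ) ^ 2)) ?_ (ae_of_all _ fun ω =>
        norm_exp_div_sub_exp_div_le (hdpos ω) hγ hr t)).trans ?_
    · exact (hd2.const_mul _).add (hI2.const_mul _)
    · rw [integral_add (hd2.const_mul _) (hI2.const_mul _), integral_const_mul, integral_const_mul,
        integral_add (hz2.const_mul _) (hd2.const_mul _), integral_const_mul, integral_const_mul]
      gcongr
  simp only [hzγ] at hcmp
  have htri := norm_sub_le_norm_sub_add_norm_sub
    (∫ ω, Complex.exp ((t * (z ω / d ω) : ℝ) * Complex.I) ∂P)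
    (∫ ω, Complex.exp ((t * ∑ i, η i ω : ℝ) * Complex.I) ∂P)
    (Complex.exp (-(v * t ^ 2 / 2 : ℝ)))
  refine htri.trans ?_
  rw [charFunError, add_comm]
  refine add_le_add (hclt.trans (le_of_eq ?_)) hcmp
  linear_combination (6 * (D : ℝ) ^ 2 * (K * L / γ) ^ 3 * r * |t| ^ 3 *
    Real.exp (v * t ^ 2 / 2)) * hNr

end Limit

/-! ### The limit along a banded family -/

section Family

variable {M β : ℕ} {α : ∀ N : ℕ, Matrix (ZMod N) (ZMod N) ℝ} {αinf : ℤ → ℤ → ℝ}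

lemma IsBandedFamily.isBandedMatrix (hα : IsBandedFamily M β α αinf) (N : ℕ) [NeZero N]
    (hMN : M ∣ N) (hN : 2 * β + 1 ≤ N) : IsBandedMatrix β (α N) αinf where
  nonneg := (mem_doublyStochastic_iff_sum.1 (hα.doublyStochastic N hMN)).1
  row_sum := (mem_doublyStochastic_iff_sum.1 (hα.doublyStochastic N hMN)).2.1
  width := hN
  support i j := by
    contrapose!
    intro h
    have := hα.band N hMN hN i.val j.val fun l => ?_
    · simpa using this
    · by_contra! hl
      refine h (mem_near.2 ⟨-(i.val - j.val + l * N), by rwa [abs_neg], ?_⟩)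
      push_cast
      simp
  limit i j h := by rw [hα.limit N hMN hN, if_pos h]
  limit_zero i j h := by rw [hα.limit N hMN hN, if_neg h.not_ge]

lemma IsBandedFamily.limit_periodic [NeZero M] (hα : IsBandedFamily M β α αinf) (i j : ℤ) :
    αinf (i + M) (j + M) = αinf i j := by
  have hM := Nat.pos_of_ne_zero (NeZero.ne M)
  have hN : 2 * β + 1 ≤ M * (2 * β + 1) := Nat.le_mul_of_pos_left _ hM
  rw [hα.limit (M * (2 * β + 1)) (dvd_mul_right _ _) hN,
    hα.limit (M * (2 * β + 1)) (dvd_mul_right _ _) hN,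
    hα.periodic (M * (2 * β + 1)) (dvd_mul_right _ _) i j 1, add_sub_add_right_eq_sub, one_mul]

variable {X : Type*} [MeasurableSpace X] {π₀ : Measure X} {f : Kernel X X}
  [IsProbabilityMeasure π₀] [IsMarkovKernel f] {g : ℕ → X → ℝ} {Ω : ℕ → Type*}
  [∀ m, MeasurableSpace (Ω m)] {P : ∀ m, Measure (Ω m)} [∀ m, IsProbabilityMeasure (P m)]
  [NeZero M] {ζ : ∀ m, ℕ → ZMod (M * (m + 1)) → Ω m → X}

/-- The central limit theorem for the general algorithm, by convergence of characteristic
functions. -/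
theorem tendstoInDistribution_weightedMean (hα : IsBandedFamily M β α αinf)
    (hS : ∀ m, IsParticleSystem π₀ (sampling (α (M * (m + 1))) f g) (P m) (ζ m))
    (hg : ∀ n, BoundedMeasurable (g n)) (hg_pos : ∀ n x, 0 < g n x) {φ : X → ℝ}
    (hφ : BoundedMeasurable φ) (n : ℕ) (hσ : 0 < asymptoticVariance M β αinf π₀ f g φ n) :
    TendstoInDistribution
      (fun m ω => √((M * (m + 1) : ℕ) : ℝ) *
        (weightedMean (weight (α (M * (m + 1))) g (fun k j => ζ m k j ω) n)
            (fun i => ζ m n i ω) φ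
          - ∫ x, φ x ∂(predictionFilter π₀ f g n)))
      atTop id P (gaussianReal 0 (asymptoticVariance M β αinf π₀ f g φ n).toNNReal) := by
  have hmeas (m : ℕ) := ((measurable_weightedMean (hS m) hg hφ.1 n).sub_const
    (∫ x, φ x ∂(predictionFilter π₀ f g n))).const_mul (√((M * (m + 1) : ℕ) : ℝ))
  refine ⟨fun m => (hmeas m).aemeasurable, aemeasurable_id, ?_⟩
  refine ProbabilityMeasure.tendsto_iff_tendsto_charFun.2 fun t => ?_
  have hlim : charFun ((gaussianReal 0 (asymptoticVariance M β αinf π₀ f g φ n).toNNReal).map id) t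
      = Complex.exp (-(asymptoticVariance M β αinf π₀ f g φ n * t ^ 2 / 2 : ℝ)) := by
    rw [Measure.map_id, charFun_gaussianReal, Real.coe_toNNReal _ hσ.le]
    congr 1
    push_cast
    ring
  simp only [ProbabilityMeasure.coe_mk]
  rw [hlim]
  choose C hC using fun n => (hg n).2
  obtain ⟨L, hL⟩ := (boundedMeasurable_centred (π₀ := π₀) (f := f) (g := g) hφ n).2
  have hMpos := Nat.pos_of_ne_zero (NeZero.ne M)
  have hle (m : ℕ) : m + 1 ≤ M * (m + 1) := Nat.le_mul_of_pos_left _ hMpos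
  have hN : Tendsto (fun m : ℕ => ((M * (m + 1) : ℕ) : ℝ)) atTop atTop :=
    tendsto_natCast_atTop_atTop.comp
      (tendsto_atTop_mono (fun m => (Nat.le_succ m).trans (hle m)) tendsto_id)
  refine tendsto_iff_norm_sub_tendsto_zero.2 ?_
  refine squeeze_zero' (Eventually.of_forall fun _ => norm_nonneg _) ?_
    (tendsto_charFunError (2 * (2 * n * β) + 1 : ℕ) (∏ k ∈ Finset.range n, C k) L
      ((unnormalised π₀ f g n).real Set.univ) (asymptoticVariance M β αinf π₀ f g φ n) t
      (tendsto_inv_atTop_zero.comp (Real.tendsto_sqrt_atTop.comp hN)))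
  filter_upwards [eventually_ge_atTop (2 * β + 4 * n * β)] with m hm
  have hm' := hle m
  have h := (hS m).norm_charFun_sub_le
    (hα.isBandedMatrix (M * (m + 1)) (dvd_mul_right _ _) (by omega)) hg hg_pos hφ n (by omega)
    hMpos.ne' rfl hα.limit_periodic (fun k x => (le_abs_self _).trans (hC k x)) hL hσ t
  rw [charFun_apply_real, integral_map (hmeas m).aemeasurable (by fun_prop)]
  simpa only [Complex.ofReal_mul, Function.comp_apply] using h

end Family

/-! ### Local exchange -/

section Exchange

variable {M N : ℕ}

lemma emod_mul_ediv (a : ℤ) {b : ℤ} (hb : 0 < b) (c : ℤ) : a % (b * c) / b = a / b % c := by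
  have h1 : a % (b * c) = a + b * (-(c * (a / (b * c)))) := by
    rw [Int.emod_def]
    ring
  rw [h1, Int.add_mul_ediv_left _ _ hb.ne', Int.emod_def, Int.ediv_ediv_of_nonneg hb.le]
  ring

lemma groupIndex_intCast [NeZero M] {m : ℕ} [NeZero (M * m)] (x : ℤ) :
    (groupIndex M (x : ZMod (M * m)) : ℤ) = (x - 1) / M % m := by
  have hM : (0 : ℤ) < M := by exact_mod_cast Nat.pos_of_ne_zero (NeZero.ne M)
  have h : (x : ZMod (M * m)) - 1 = ((x - 1 : ℤ) : ZMod (M * m)) := by push_cast; rfl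
  rw [groupIndex, h, Int.natCast_ediv, ZMod.val_intCast, Nat.cast_mul, emod_mul_ediv _ hM]

lemma card_groupIndex_eq [NeZero M] [NeZero N] (hMN : M ∣ N) (i : ZMod N) :
    (Finset.univ.filter fun j : ZMod N => groupIndex M j = groupIndex M i).card = M := by
  obtain ⟨m, rfl⟩ := hMN
  have hM : 0 < M := Nat.pos_of_ne_zero (NeZero.ne M)
  have hk : groupIndex M i < m :=
    Nat.div_lt_of_lt_mul (ZMod.val_lt (i - 1))
  set k := groupIndex M i
  rw [show (Finset.univ.filter fun j : ZMod (M * m) => groupIndex M j = k)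
      = (Finset.Ico (M * k) (M * k + M)).image fun t : ℕ => (t : ZMod (M * m)) + 1 from ?_,
    Finset.card_image_of_injOn, Nat.card_Ico, Nat.add_sub_cancel_left]
  · intro a ha b hb hab
    rw [Finset.coe_Ico, Set.mem_Ico] at ha hb
    have hab' : ((a : ℤ) : ZMod (M * m)) = (b : ℤ) := by simpa using hab
    have hN : M ≤ M * m := Nat.le_mul_of_pos_right _ (by omega)
    have := intCast_eq_of_abs_lt hab' (by rw [abs_lt]; constructor <;> omega)
    exact_mod_cast this
  · ext j
    simp only [Finset.mem_filter, Finset.mem_univ, true_and, Finset.mem_image, Finset.mem_Ico]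
    constructor
    · intro h
      refine ⟨(j - 1).val, ?_, by simp⟩
      rw [← h, groupIndex]
      exact ⟨Nat.mul_div_le _ _, by
        have := Nat.lt_mul_div_succ (j - 1).val hM
        rwa [mul_add_one] at this⟩
    · rintro ⟨t, ⟨h1, h2⟩, rfl⟩
      have hlt : t < M * m := by
        have : M * (k + 1) ≤ M * m := Nat.mul_le_mul_left _ hk
        rw [mul_add_one] at this
        omega
      rw [groupIndex, add_sub_cancel_right, ZMod.val_natCast_of_lt hlt]
      exact Nat.div_eq_of_lt_le (by linarith) (by rw [add_one_mul]; linarith)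

/-- The matrices `α_N^{ij} = M⁻¹ 𝟙[j - θ lies in the group of i]` of the local exchange particle
filter; its weights are `(M / N)^n` times those of the general algorithm for these matrices. -/
def exchangeMatrix (M θ N : ℕ) : Matrix (ZMod N) (ZMod N) ℝ :=
  fun i j => if groupIndex M (j - (θ : ZMod N)) = groupIndex M i then (M : ℝ)⁻¹ else 0

lemma sum_exchangeMatrix_mul [NeZero N] (θ : ℕ) (i : ZMod N) (F : ZMod N → ℝ) :
    ∑ j, exchangeMatrix M θ N i j * F j
      = (M : ℝ)⁻¹ * ∑ j : ZMod N with groupIndex M j = groupIndex M i, F (j + θ) := by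
  rw [← Equiv.sum_comp (Equiv.addRight (θ : ZMod N)) fun j => exchangeMatrix M θ N i j * F j,
    Finset.mul_sum, Finset.sum_filter]
  simp [exchangeMatrix]

lemma exchangeMatrix_intCast [NeZero M] {m : ℕ} [NeZero (M * m)] (θ : ℕ) (i j : ℤ) :
    exchangeMatrix M θ (M * m) i j
      = if (m : ℤ) ∣ (i - 1) / M - (j - θ - 1) / M then (M : ℝ)⁻¹ else 0 := by
  have h : (j : ZMod (M * m)) - θ = ((j - θ : ℤ) : ZMod (M * m)) := by push_cast; rfl
  rw [exchangeMatrix, h]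
  refine if_congr ?_ rfl rfl
  rw [← @Nat.cast_inj ℤ, groupIndex_intCast, groupIndex_intCast, ← Int.ModEq,
    Int.modEq_iff_dvd]

/-- If the groups of `i` and of `j - θ` have numbers which differ by `l`, then `i - j` is close to
`l M`. -/
lemma abs_sub_sub_mul_le [NeZero M] {θ : ℕ} {i j l : ℤ}
    (h : (i - 1) / M - (j - θ - 1) / M = l) : |i - j + θ - l * M| ≤ M - 1 := by
  have hM : (0 : ℤ) < M := by exact_mod_cast Nat.pos_of_ne_zero (NeZero.ne M)
  have h1 := Int.emod_add_mul_ediv (i - 1) M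
  have h2 := Int.emod_add_mul_ediv (j - θ - 1) M
  have h3 := Int.emod_nonneg (i - 1) hM.ne'
  have h4 := Int.emod_lt_of_pos (i - 1) hM
  have h5 := Int.emod_nonneg (j - θ - 1) hM.ne'
  have h6 := Int.emod_lt_of_pos (j - θ - 1) hM
  have h7 : i - j + θ - l * M = (i - 1) % M - (j - θ - 1) % M := by
    rw [← h]
    linear_combination h2 - h1
  rw [h7, abs_le]
  constructor <;> omega

lemma isBandedFamily_exchangeMatrix (M θ : ℕ) [NeZero M] :
    IsBandedFamily M (M - 1 + θ) (exchangeMatrix M θ) (exchangeLimit M θ) where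
  doublyStochastic N _ hMN := by
    have hM0 : (M : ℝ) ≠ 0 := by exact_mod_cast NeZero.ne M
    refine mem_doublyStochastic_iff_sum.2 ⟨fun i j => ?_, fun i => ?_, fun j => ?_⟩
    · rw [exchangeMatrix]
      positivity
    · have := sum_exchangeMatrix_mul (M := M) θ i fun _ => 1
      simp only [mul_one] at this
      rw [this, Finset.sum_const, card_groupIndex_eq hMN, nsmul_eq_mul, mul_one,
        inv_mul_cancel₀ hM0]
    · simp only [exchangeMatrix, eq_comm (a := groupIndex M (j - (θ : ZMod N)))]
      rw [← Finset.sum_filter, Finset.sum_const, card_groupIndex_eq hMN, nsmul_eq_mul,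
        mul_inv_cancel₀ hM0]
  periodic N _ hMN i j z := by
    obtain ⟨m, rfl⟩ := hMN
    have hM : (M : ℤ) ≠ 0 := by exact_mod_cast NeZero.ne M
    rw [exchangeMatrix_intCast, exchangeMatrix_intCast,
      show i + z * M - 1 = i - 1 + z * M by ring,
      show j + z * M - θ - 1 = j - θ - 1 + z * M by ring, Int.add_mul_ediv_right _ _ hM,
      Int.add_mul_ediv_right _ _ hM, add_sub_add_right_eq_sub]
  band N _ hMN _ i j h := by
    obtain ⟨m, rfl⟩ := hMN
    have hM := Nat.pos_of_ne_zero (NeZero.ne M)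
    rw [exchangeMatrix_intCast, if_neg]
    rintro ⟨l, hl⟩
    have h1 := abs_sub_sub_mul_le hl
    have h2 := h (-l)
    have h3 : i - j + θ - m * l * M = i - j + -l * (M * m : ℕ) + θ := by push_cast; ring
    rw [h3, abs_le] at h1
    rw [lt_abs] at h2
    omega
  limit N _ hMN hN i j := by
    obtain ⟨m, rfl⟩ := hMN
    have hM := Nat.pos_of_ne_zero (NeZero.ne M)
    rw [exchangeMatrix_intCast, exchangeLimit]
    by_cases h1 : (i - 1) / (M : ℤ) = (j - θ - 1) / M
    · have h := abs_sub_sub_mul_le (M := M) (i := i) (j := j) (θ := θ) (l := 0) (by omega)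
      rw [abs_le] at h
      rw [if_pos h1, if_pos (abs_le.2 (by omega)), if_pos]
      rw [h1, sub_self]
      exact dvd_zero _
    · rw [if_neg h1]
      split_ifs with h2 h3
      · -- the groups agree modulo `m`, and `i`, `j` are too close for them to be distinct
        exfalso
        obtain ⟨l, hl⟩ := h3
        have h4 := abs_sub_sub_mul_le hl
        have h5 : m * l * M = (M * m : ℕ) * l := by push_cast; ring
        rw [h5, abs_le] at h4
        rw [abs_le] at h2
        rcases lt_trichotomy l 0 with h | h | h
        · have : ((M * m : ℕ) : ℤ) * l ≤ (M * m : ℕ) * (-1) :=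
            mul_le_mul_of_nonneg_left (by omega) (by positivity)
          omega
        · rw [h, mul_zero] at hl
          omega
        · have : ((M * m : ℕ) : ℤ) * 1 ≤ (M * m : ℕ) * l :=
            mul_le_mul_of_nonneg_left (by omega) (by positivity)
          omega
      · rfl
      · rfl

variable {X : Type*} [MeasurableSpace X] {f : Kernel X X} {g : ℕ → X → ℝ}

lemma exchangeWeight_eq [NeZero M] [NeZero N] (θ n : ℕ) (z : ℕ → ZMod N → X) (i : ZMod N) :
    exchangeWeight M θ g z n i = (M / N : ℝ) ^ n * weight (exchangeMatrix M θ N) g z n i := by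
  have hM0 : (M : ℝ) ≠ 0 := by exact_mod_cast NeZero.ne M
  induction n generalizing i with
  | zero => simp [exchangeWeight, weight]
  | succ n ih =>
    simp only [exchangeWeight, weight, ih, mul_assoc]
    rw [sum_exchangeMatrix_mul θ i fun j => weight (exchangeMatrix M θ N) g z n j * g n (z n j),
      ← Finset.mul_sum, pow_succ]
    field_simp

lemma exchangeSampling_eq [NeZero M] [NeZero N] (θ : ℕ) :
    exchangeSampling (N := N) M θ f g = sampling (exchangeMatrix M θ N) f g := by
  have hM0 : (M : ℝ) ≠ 0 := by exact_mod_cast NeZero.ne M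
  have hN0 : (N : ℝ) ≠ 0 := by exact_mod_cast NeZero.ne N
  funext n i z A
  simp only [exchangeSampling, sampling, weight, exchangeWeight_eq, mul_assoc]
  rw [sum_exchangeMatrix_mul θ i fun j => weight (exchangeMatrix M θ N) g z n j * g n (z n j),
    sum_exchangeMatrix_mul θ i fun j => weight (exchangeMatrix M θ N) g z n j *
      (g n (z n j) * (f (z n j)).real A), ← Finset.mul_sum, ← Finset.mul_sum,
    mul_div_mul_left _ _ (pow_ne_zero _ (div_ne_zero hM0 hN0)), inv_mul_eq_div,
    mul_div_mul_left _ _ (inv_ne_zero hM0)]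

lemma weightedMean_exchangeWeight [NeZero M] [NeZero N] (θ n : ℕ) (z : ℕ → ZMod N → X)
    (φ : X → ℝ) :
    weightedMean (exchangeWeight M θ g z n) (z n) φ
      = weightedMean (weight (exchangeMatrix M θ N) g z n) (z n) φ := by
  have hM0 : (M : ℝ) ≠ 0 := by exact_mod_cast NeZero.ne M
  have hN0 : (N : ℝ) ≠ 0 := by exact_mod_cast NeZero.ne N
  simp only [weightedMean, exchangeWeight_eq, mul_assoc, ← Finset.mul_sum]
  rw [mul_div_mul_left _ _ (pow_ne_zero _ (div_ne_zero hM0 hN0))]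

variable {π₀ : Measure X} [IsProbabilityMeasure π₀] [IsMarkovKernel f] {Ω : ℕ → Type*}
  [∀ m, MeasurableSpace (Ω m)] {P : ∀ m, Measure (Ω m)} [∀ m, IsProbabilityMeasure (P m)]
  [NeZero M] {ζ : ∀ m, ℕ → ZMod (M * (m + 1)) → Ω m → X}

/-- The central limit theorem for the local exchange particle filter, or, for `θ = 0`, independent
bootstrap particle filters. -/
theorem tendstoInDistribution_exchange {θ : ℕ}
    (hS : ∀ m, IsParticleSystem π₀ (exchangeSampling M θ f g) (P m) (ζ m))
    (hg : ∀ n, BoundedMeasurable (g n)) (hg_pos : ∀ n x, 0 < g n x) {φ : X → ℝ}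
    (hφ : BoundedMeasurable φ) (n : ℕ)
    (hσ : 0 < asymptoticVariance M (M - 1 + θ) (exchangeLimit M θ) π₀ f g φ n) :
    TendstoInDistribution
      (fun m ω => √((M * (m + 1) : ℕ) : ℝ) *
        (weightedMean (exchangeWeight M θ g (fun k j => ζ m k j ω) n) (fun i => ζ m n i ω) φ
          - ∫ x, φ x ∂(predictionFilter π₀ f g n)))
      atTop id P
      (gaussianReal 0
        (asymptoticVariance M (M - 1 + θ) (exchangeLimit M θ) π₀ f g φ n).toNNReal) := by
  have h := tendstoInDistribution_weightedMean (isBandedFamily_exchangeMatrix M θ)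
    (fun m => by rw [← exchangeSampling_eq]; exact hS m) hg hg_pos hφ n hσ
  have hw (m : ℕ) (ω : Ω m) := weightedMean_exchangeWeight (M := M) (g := g) θ n
    (fun k j => ζ m k j ω) φ
  simpa only [hw] using h

end Exchange

end AlphaSMC

end

theorem theorem1 {X : Type*} [MeasurableSpace X] [StandardBorelSpace X]
    (π₀ : Measure X) [IsProbabilityMeasure π₀]
    (f : Kernel X X) [IsMarkovKernel f]
    (g : ℕ → X → ℝ) (hg_meas : ∀ n, Measurable (g n)) (hg_bdd : ∀ n, ∃ C, ∀ x, g n x ≤ C)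
    (hg_pos : ∀ n x, 0 < g n x)
    (M : ℕ) [NeZero M] (hM : 1 < M)
    {Ω : ℕ → Type*} [∀ m, MeasurableSpace (Ω m)]
    (P : ∀ m, Measure (Ω m)) [∀ m, IsProbabilityMeasure (P m)]
    (ζ : ∀ m, ℕ → ZMod (M * (m + 1)) → Ω m → X)
    (φ : X → ℝ) (hφ_meas : Measurable φ) (hφ_bdd : ∃ C, ∀ x, |φ x| ≤ C) :
    -- the general algorithm, with matrices `α_N`
    (∀ (β : ℕ) (α : ∀ N : ℕ, Matrix (ZMod N) (ZMod N) ℝ) (αinf : ℤ → ℤ → ℝ), 0 < β →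
      AlphaSMC.IsBandedFamily M β α αinf →
      (∀ m, AlphaSMC.IsParticleSystem π₀
        (AlphaSMC.sampling (α (M * (m + 1))) f g) (P m) (ζ m)) →
      ∀ n, 0 < AlphaSMC.asymptoticVariance M β αinf π₀ f g φ n →
        TendstoInDistribution
          (fun m ω => √((M * (m + 1) : ℕ) : ℝ) *
            (AlphaSMC.weightedMean
                (AlphaSMC.weight (α (M * (m + 1))) g (fun k j => ζ m k j ω) n)
                (fun i => ζ m n i ω) φ
              - ∫ x, φ x ∂(AlphaSMC.predictionFilter π₀ f g n)))
          atTop id P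
          (gaussianReal 0 (AlphaSMC.asymptoticVariance M β αinf π₀ f g φ n).toNNReal)) ∧
    -- the local exchange particle filter
    (∀ θ : ℕ, 1 ≤ θ → θ ≤ M - 1 →
      (∀ m, AlphaSMC.IsParticleSystem π₀ (AlphaSMC.exchangeSampling M θ f g) (P m) (ζ m)) →
      ∀ n, 0 < AlphaSMC.asymptoticVariance M (M - 1 + θ)
          (AlphaSMC.exchangeLimit M θ) π₀ f g φ n →
        TendstoInDistribution
          (fun m ω => √((M * (m + 1) : ℕ) : ℝ) *
            (AlphaSMC.weightedMean
                (AlphaSMC.exchangeWeight M θ g (fun k j => ζ m k j ω) n)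
                (fun i => ζ m n i ω) φ
              - ∫ x, φ x ∂(AlphaSMC.predictionFilter π₀ f g n)))
          atTop id P
          (gaussianReal 0 (AlphaSMC.asymptoticVariance M (M - 1 + θ)
            (AlphaSMC.exchangeLimit M θ) π₀ f g φ n).toNNReal)) ∧
    -- independent bootstrap particle filters
    ((∀ m, AlphaSMC.IsParticleSystem π₀ (AlphaSMC.exchangeSampling M 0 f g) (P m) (ζ m)) →
      ∀ n, 0 < AlphaSMC.asymptoticVariance M (M - 1)
          (AlphaSMC.exchangeLimit M 0) π₀ f g φ n →
        TendstoInDistribution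
          (fun m ω => √((M * (m + 1) : ℕ) : ℝ) *
            (AlphaSMC.weightedMean
                (AlphaSMC.exchangeWeight M 0 g (fun k j => ζ m k j ω) n)
                (fun i => ζ m n i ω) φ
              - ∫ x, φ x ∂(AlphaSMC.predictionFilter π₀ f g n)))
          atTop id P
          (gaussianReal 0 (AlphaSMC.asymptoticVariance M (M - 1)
            (AlphaSMC.exchangeLimit M 0) π₀ f g φ n).toNNReal)) := by
  have hg (n : ℕ) : AlphaSMC.BoundedMeasurable (g n) := by
    obtain ⟨C, hC⟩ := hg_bdd n
    exact ⟨hg_meas n, C, fun x => by rw [abs_of_pos (hg_pos n x)]; exact hC x⟩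
  have hφ : AlphaSMC.BoundedMeasurable φ := ⟨hφ_meas, hφ_bdd⟩
  exact ⟨fun _ _ _ _ hα hS n hσ =>
      AlphaSMC.tendstoInDistribution_weightedMean hα hS hg hg_pos hφ n hσ,
    fun _ _ _ hS n hσ => AlphaSMC.tendstoInDistribution_exchange hS hg hg_pos hφ n hσ,
    fun hS n hσ => AlphaSMC.tendstoInDistribution_exchange (θ := 0) hS hg hg_pos hφ n hσ⟩
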